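/- **Conventions.** For \(v\in\mathbb R^d\) let \(\|v\|_0\) be the number of nonzero coordinates and \(P(v)=\|v\|_0\log(ed/\|v\|_0)\), with \(P(0)=0\); \(\log 0=-\infty\). A real random variable \(\xi\) is called sub-Gaussian\((0,\sigma^2)\), \(\sigma>0\), if \(\mathbb E\xi=0\) and \(\mathbb E\exp(\xi^2/\sigma^2)\le 2\). Consider the linear model \(y=X\beta^*+\gamma^*+\epsilon\) with \(X\in\mathbb R^{n\times p}\), \(\beta^*\in\mathbb R^p\), \(\gamma^*\in\mathbb R^n\), where \(\epsilon_1,\dots,\epsilon_n\) are independent sub-Gaussian\((0,\sigma^2)\) with unknown \(\sigma>0\) and \(\mathbb E\epsilon_i^2=c_i\sigma^2\), \(c_i\ge c_0\), for a constant \(c_0>0\). Write \(o^*=\|\gamma^*\|_0\), \(s^*=\|\beta^*\|_0\). **Theorem 8.** There is \(A_{\min}>0\) depending only on \(c_0\) such that for all constants \(A\ge A_{\min}\) and \(A_0>A\) there are constants \(C,c,c'>0\), depending only on \(c_0,A,A_0\), with the following property. Let \(n>p\), let \(X\) have full column rank and let \(P(\gamma^*)\le (n-p)/A_0\). Put \(\delta(\gamma)=A\,P(\gamma)/(n-p)\).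 Then, on an event of probability at least \(1-c(n-p)^{-c'}\) if \(o^*\ge 1\), and at least \(1-c(n-p)^{-c'}-c\,e^{-c'p}\) if \(o^*=0\), every minimizer \((\hat\beta,\hat\gamma)\) of \[\log\|X\beta+\gamma-y\|_2^2+\delta(\gamma)\quad\text{subject to }\delta(\gamma)<1\] satisfies \[\tfrac12\|X\hat\beta+\hat\gamma-X\beta^*-\gamma^*\|_2^2\le C\big(\sigma^2 P(\gamma^*)+p\sigma^2\big).\] **Theorem 8′.** There is \(A_{\min}>0\) depending only on \(c_0\) such that for all constants \(A\ge A_{\min}\) and \(A_0>A\) there are constants \(K,C,C',c,c'>0\), depending only on \(c_0,A,A_0\), with the following property. Let \(n\ge1\), let \(X\) be arbitrary (in particular \(p>n\) is allowed) and let \(P(\beta^*)+P(\gamma^*)\le n/A_0\). Put \(\delta(\beta,\gamma)=A\{P(\beta)+P(\gamma)\}/n\). Then, on an event of probability at least \(1-C'n^{-c'}-C\,n^{-c(1\wedge o^*)}p^{-c(1\wedge s^*)}\) (with \(0^0=1\)), every minimizer \((\hat\beta,\hat\gamma)\) of \[\log\big(\tfrac12\|X\beta+\gamma-y\|_2^2\big)+\delta(\beta,\gamma)\quad\text{subject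 to }\delta(\beta,\gamma)<1\] satisfies \[\tfrac12\|X\hat\beta+\hat\gamma-X\beta^*-\gamma^*\|_2^2\le K\sigma^2\big(P(\beta^*)+P(\gamma^*)\big).\] -/

import Mathlib

open MeasureTheory ProbabilityTheory

noncomputable section

/-- `ξ` is a sub-Gaussian(0, σ²) random variable (for `σ > 0`): it is centered and its
`ψ₂`-norm `inf {s > 0 : E exp (ξ² / s²) ≤ 2}` is at most `σ`. -/
structure IsSubGaussian {Ω : Type*} [MeasurableSpace Ω] (ξ : Ω → ℝ) (σ : ℝ)
    (μ : Measure Ω) : Prop where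
  measurable : Measurable ξ
  mean_zero : ∫ ω, ξ ω ∂μ = 0
  psi_two_le : ∫⁻ ω, ENNReal.ofReal (Real.exp (ξ ω ^ 2 / σ ^ 2)) ∂μ ≤ 2

/-- The squared Euclidean norm on `ℝⁿ`. -/
def sqNorm {n : ℕ} (v : Fin n → ℝ) : ℝ := ‖WithLp.toLp 2 v‖ ^ 2

/-- The Bregman divergence `D₂(a, b) = ‖a - b‖² / 2` of half the squared Euclidean norm. -/
def breg2 {n : ℕ} (a b : Fin n → ℝ) : ℝ := sqNorm (a - b) / 2

/-- The systematic component `X β + γ`. -/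
def sysComp {n p : ℕ} (X : Matrix (Fin n) (Fin p) ℝ) (β : Fin p → ℝ) (γ : Fin n → ℝ) :
    Fin n → ℝ :=
  X.mulVec β + γ

/-- The complexity `‖v‖₀ log (e d / ‖v‖₀)` of a vector of dimension `d`, where `‖v‖₀` is the
number of nonzero coordinates. It is zero at `v = 0`. -/
def complexity {d : ℕ} (v : Fin d → ℝ) : ℝ :=
  (hammingNorm v : ℝ) * Real.log (Real.exp 1 * d / hammingNorm v)

/-- The logarithm of a nonnegative real number, with `log 0 = -∞`. -/
def extLog (t : ℝ) : EReal := ENNReal.log (ENNReal.ofReal t)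

/-- `δ(γ) = A ‖γ‖₀ log (e n / ‖γ‖₀) / (n - p)`. -/
def lowPenalty {n : ℕ} (p : ℕ) (A : ℝ) (γ : Fin n → ℝ) : ℝ :=
  A * complexity γ / ((n : ℝ) - p)

/-- `(β, γ)` minimizes `log ‖X β + γ - y‖² + δ(γ)` subject to `δ(γ) < 1`. -/
def IsLowMinimizer {n p : ℕ} (A : ℝ) (X : Matrix (Fin n) (Fin p) ℝ) (y : Fin n → ℝ)
    (β : Fin p → ℝ) (γ : Fin n → ℝ) : Prop :=
  lowPenalty p A γ < 1 ∧
    ∀ (β' : Fin p → ℝ) (γ' : Fin n → ℝ), lowPenalty p A γ' < 1 →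
      extLog (sqNorm (sysComp X β γ - y)) + (lowPenalty p A γ : EReal) ≤
        extLog (sqNorm (sysComp X β' γ' - y)) + (lowPenalty p A γ' : EReal)

/-- `δ(β, γ) = A {‖β‖₀ log (e p / ‖β‖₀) + ‖γ‖₀ log (e n / ‖γ‖₀)} / n`. -/
def highPenalty {n p : ℕ} (A : ℝ) (β : Fin p → ℝ) (γ : Fin n → ℝ) : ℝ :=
  A * (complexity β + complexity γ) / n

/-- `(β, γ)` minimizes `log (‖X β + γ - y‖² / 2) + δ(β, γ)` subject to `δ(β, γ) < 1`. -/
def IsHighMinimizer {n p : ℕ} (A : ℝ) (X : Matrix (Fin n) (Fin p) ℝ) (y : Fin n → ℝ)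
    (β : Fin p → ℝ) (γ : Fin n → ℝ) : Prop :=
  highPenalty A β γ < 1 ∧
    ∀ (β' : Fin p → ℝ) (γ' : Fin n → ℝ), highPenalty A β' γ' < 1 →
      extLog (sqNorm (sysComp X β γ - y) / 2) + (highPenalty A β γ : EReal) ≤
        extLog (sqNorm (sysComp X β' γ' - y) / 2) + (highPenalty A β' γ' : EReal)

end

/-! Exponentiating the comparison of a minimizer with the truth gives `‖D - e‖² exp δ ≤ ‖e‖² exp
δs`, where `D` is the error and `e` the noise. Since `‖e‖²` is of order `N σ²` and both penalties
lie in `[0, 1]`, linearizing `exp (δs - δ)` turns a penalty `A P / N` into one of order `A σ² P`: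
the residual itself supplies the unknown scale `σ²`. What remains is the usual argument for
penalized least squares (`norm_sq_le_of_log_criterion`). The cross term `⟨D, e⟩` sees only the
projection of the noise on the subspace determined by the estimated and true supports. A union bound
over supports makes its squared length at most a multiple of `σ² (P + Ps)`, and a large `A` absorbs
the part with the estimated complexity `P`.

Two facts about the noise are needed. `lintegral_exp_sum_sq_inner_le` gives exponential upper tails
for projections, strong enough for the union bound. Chebyshev's inequality for a quadratic form
gives the lower bound on `‖e‖²`, with failure probability of order `1 / N`.

For a full-rank design with unpenalized `β`, `profile_criterion` minimizes over the column space.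
The argument then runs in its orthogonal complement, of dimension `n - p`, and the noise inside the
column space contributes the term `p σ²`. -/

/-! ### Moments of one sub-Gaussian variable. -/

theorem Real.exp_le_add_exp_sq (x : ℝ) : Real.exp x ≤ x + Real.exp (x ^ 2) := by
  have h2 := Real.add_one_le_exp (x ^ 2)
  by_cases h : |x| ≤ 1
  · have h1 := Real.abs_exp_sub_one_sub_id_le h
    have h3 := (abs_le.1 h1).2
    linarith
  · rcases lt_abs.1 (not_le.1 h) with h' | h'
    · have : Real.exp x ≤ Real.exp (x ^ 2) := Real.exp_le_exp.2 (by nlinarith)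
      linarith
    · have : Real.exp x ≤ 1 := Real.exp_le_one_iff.2 (by linarith)
      nlinarith

theorem Real.exp_mul_le_of_mem_Icc {a : ℝ} (ha : 0 ≤ a) (ha1 : a ≤ 1) (s : ℝ) :
    Real.exp (a * s) ≤ 1 - a + a * Real.exp s := by
  have h := convexOn_exp.2 (Set.mem_univ (0 : ℝ)) (Set.mem_univ s) (sub_nonneg.2 ha1) ha
    (by ring)
  simpa using h

namespace IsSubGaussian

variable {Ω : Type*} [MeasurableSpace Ω] {ξ : Ω → ℝ} {σ : ℝ} {μ : Measure Ω}

theorem integrable_exp (h : IsSubGaussian ξ σ μ) :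
    Integrable (fun ω => Real.exp (ξ ω ^ 2 / σ ^ 2)) μ := by
  have := h.measurable
  refine ⟨by fun_prop, ?_⟩
  rw [hasFiniteIntegral_iff_ofReal (Filter.Eventually.of_forall fun _ => (Real.exp_pos _).le)]
  exact h.psi_two_le.trans_lt (by simp)

theorem integral_exp_le (h : IsSubGaussian ξ σ μ) :
    ∫ ω, Real.exp (ξ ω ^ 2 / σ ^ 2) ∂μ ≤ 2 := by
  rw [integral_eq_lintegral_of_nonneg_ae (Filter.Eventually.of_forall fun _ => (Real.exp_pos _).le)
    h.integrable_exp.1]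
  exact ENNReal.toReal_le_of_le_ofReal (by norm_num) (by simpa using h.psi_two_le)

theorem pow_four_le (hσ : 0 < σ) (x : ℝ) : x ^ 4 ≤ 2 * σ ^ 4 * Real.exp (x ^ 2 / σ ^ 2) := by
  have h := Real.quadratic_le_exp_of_nonneg (x := x ^ 2 / σ ^ 2) (by positivity)
  have h1 : (x ^ 2 / σ ^ 2) ^ 2 / 2 ≤ Real.exp (x ^ 2 / σ ^ 2) := by
    have : 0 ≤ x ^ 2 / σ ^ 2 := by positivity
    linarith
  have h2 : x ^ 4 = 2 * σ ^ 4 * ((x ^ 2 / σ ^ 2) ^ 2 / 2) := by field_simp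
  rw [h2]
  gcongr

theorem integrable_pow_four (h : IsSubGaussian ξ σ μ) (hσ : 0 < σ) :
    Integrable (fun ω => ξ ω ^ 4) μ := by
  have := h.measurable
  refine (h.integrable_exp.const_mul (2 * σ ^ 4)).mono' (by fun_prop) ?_
  refine Filter.Eventually.of_forall fun ω => ?_
  rw [Real.norm_of_nonneg (by positivity)]
  exact pow_four_le hσ _

theorem integral_pow_four_le (h : IsSubGaussian ξ σ μ) (hσ : 0 < σ) :
    ∫ ω, ξ ω ^ 4 ∂μ ≤ 4 * σ ^ 4 := by
  calc ∫ ω, ξ ω ^ 4 ∂μ ≤ ∫ ω, 2 * σ ^ 4 * Real.exp (ξ ω ^ 2 / σ ^ 2) ∂μ :=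
        integral_mono (h.integrable_pow_four hσ) (h.integrable_exp.const_mul _)
          fun ω => pow_four_le hσ _
    _ ≤ 2 * σ ^ 4 * 2 := by
        rw [integral_const_mul]
        gcongr
        exact h.integral_exp_le
    _ = 4 * σ ^ 4 := by ring

theorem memLp_four (h : IsSubGaussian ξ σ μ) (hσ : 0 < σ) : MemLp ξ 4 μ := by
  have := h.measurable
  refine (integrable_norm_rpow_iff (by fun_prop) (by simp) (by simp)).1 ?_
  refine (h.integrable_pow_four hσ).congr (Filter.Eventually.of_forall fun ω => ?_)
  simp only [Real.norm_eq_abs, ENNReal.toReal_ofNat]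
  rw [show (4 : ℝ) = (4 : ℕ) by norm_num, Real.rpow_natCast, pow_abs, abs_of_nonneg (by positivity)]

variable [IsProbabilityMeasure μ]

theorem integrable (h : IsSubGaussian ξ σ μ) (hσ : 0 < σ) : Integrable ξ μ :=
  (h.memLp_four hσ).integrable (by norm_num)

theorem integrable_sq (h : IsSubGaussian ξ σ μ) (hσ : 0 < σ) :
    Integrable (fun ω => ξ ω ^ 2) μ :=
  ((h.memLp_four hσ).mono_exponent (p := 2) (by norm_num)).integrable_sq

theorem integral_sq_le (h : IsSubGaussian ξ σ μ) (hσ : 0 < σ) :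
    ∫ ω, ξ ω ^ 2 ∂μ ≤ σ ^ 2 := by
  have hb : ∀ x : ℝ, x ^ 2 ≤ σ ^ 2 * (Real.exp (x ^ 2 / σ ^ 2) - 1) := fun x => by
    have := Real.add_one_le_exp (x ^ 2 / σ ^ 2)
    calc x ^ 2 = σ ^ 2 * (x ^ 2 / σ ^ 2) := by field_simp
      _ ≤ _ := by gcongr; linarith
  calc ∫ ω, ξ ω ^ 2 ∂μ ≤ ∫ ω, σ ^ 2 * (Real.exp (ξ ω ^ 2 / σ ^ 2) - 1) ∂μ :=
        integral_mono (h.integrable_sq hσ)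
          ((h.integrable_exp.sub (integrable_const 1)).const_mul _) fun ω => hb _
    _ ≤ σ ^ 2 * (2 - 1) := by
        rw [integral_const_mul, integral_sub h.integrable_exp (integrable_const 1)]
        gcongr
        · exact h.integral_exp_le
        · simp
    _ = σ ^ 2 := by ring

/-- The moment generating function of a centered variable with `ψ₂`-norm at most `σ`. -/
theorem integrable_exp_mul_and_le (h : IsSubGaussian ξ σ μ) (hσ : 0 < σ) (t : ℝ) :
    Integrable (fun ω => Real.exp (t * ξ ω)) μ ∧
      ∫ ω, Real.exp (t * ξ ω) ∂μ ≤ Real.exp (σ ^ 2 * t ^ 2) := by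
  have hm := h.measurable
  have key : ∀ g : Ω → ℝ, Integrable g μ → (∀ ω, Real.exp (t * ξ ω) ≤ g ω) →
      ∫ ω, g ω ∂μ ≤ Real.exp (σ ^ 2 * t ^ 2) →
      Integrable (fun ω => Real.exp (t * ξ ω)) μ ∧
        ∫ ω, Real.exp (t * ξ ω) ∂μ ≤ Real.exp (σ ^ 2 * t ^ 2) := fun g hg hle hint => by
    have hi : Integrable (fun ω => Real.exp (t * ξ ω)) μ :=
      hg.mono' (by fun_prop) (Filter.Eventually.of_forall fun ω => by
        rw [Real.norm_of_nonneg (Real.exp_pos _).le]; exact hle ω)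
    exact ⟨hi, (integral_mono hi hg hle).trans hint⟩
  -- For small `t`, centering removes the linear term of `x + exp (x²)` and convexity bounds the
  -- rest by `1 + a ≤ exp a`. For large `t`, `tξ ≤ a/2 + ξ²/(2σ²)` loses a factor `3/2`, which `exp
  -- (a/2)` absorbs.
  by_cases hc : σ ^ 2 * t ^ 2 ≤ 1
  · set a := σ ^ 2 * t ^ 2 with ha
    have ha0 : 0 ≤ a := by positivity
    have hi1 := (h.integrable hσ).const_mul t
    have hi2 := h.integrable_exp.const_mul a
    refine key (fun ω => t * ξ ω + ((1 - a) + a * Real.exp (ξ ω ^ 2 / σ ^ 2)))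
      (hi1.add ((integrable_const _).add hi2)) (fun ω => ?_) ?_
    · refine (Real.exp_le_add_exp_sq _).trans ?_
      have := Real.exp_mul_le_of_mem_Icc ha0 hc (ξ ω ^ 2 / σ ^ 2)
      have e : a * (ξ ω ^ 2 / σ ^ 2) = (t * ξ ω) ^ 2 := by rw [ha]; field_simp
      rw [e] at this
      linarith
    · have e1 : ∫ ω, (t * ξ ω + ((1 - a) + a * Real.exp (ξ ω ^ 2 / σ ^ 2))) ∂μ =
          (1 - a) + a * ∫ ω, Real.exp (ξ ω ^ 2 / σ ^ 2) ∂μ := by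
        rw [integral_add hi1 (g := fun ω => (1 - a) + a * Real.exp (ξ ω ^ 2 / σ ^ 2))
          ((integrable_const _).add hi2), integral_add (integrable_const _) hi2, integral_const_mul, integral_const_mul,
          h.mean_zero]
        simp
      rw [e1]
      have := mul_le_mul_of_nonneg_left h.integral_exp_le ha0
      have := Real.add_one_le_exp a
      linarith
  · set a := σ ^ 2 * t ^ 2 with ha
    have hi2 := (h.integrable_exp.const_mul (1 / 2)).const_mul (Real.exp (a / 2))
    refine key (fun ω => Real.exp (a / 2) * (1 / 2) +
      Real.exp (a / 2) * (1 / 2 * Real.exp (ξ ω ^ 2 / σ ^ 2)))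
      ((integrable_const _).add hi2) (fun ω => ?_) ?_
    · have h1 := Real.exp_mul_le_of_mem_Icc (a := 1 / 2) (by norm_num) (by norm_num)
        (ξ ω ^ 2 / σ ^ 2)
      have h2 : t * ξ ω ≤ a / 2 + 1 / 2 * (ξ ω ^ 2 / σ ^ 2) := by
        have e : (σ * t - ξ ω / σ) ^ 2 = a - 2 * (t * ξ ω) + ξ ω ^ 2 / σ ^ 2 := by
          rw [ha]; field_simp; ring
        nlinarith [sq_nonneg (σ * t - ξ ω / σ)]
      calc Real.exp (t * ξ ω) ≤ Real.exp (a / 2 + 1 / 2 * (ξ ω ^ 2 / σ ^ 2)) :=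
            Real.exp_le_exp.2 h2
        _ = Real.exp (a / 2) * Real.exp (1 / 2 * (ξ ω ^ 2 / σ ^ 2)) := Real.exp_add _ _
        _ ≤ Real.exp (a / 2) * (1 - 1 / 2 + 1 / 2 * Real.exp (ξ ω ^ 2 / σ ^ 2)) := by gcongr
        _ = _ := by ring
    · rw [integral_add (integrable_const _) hi2, integral_const_mul, integral_const_mul,
        integral_const_mul]
      have h3 : Real.exp a = Real.exp (a / 2) * Real.exp (a / 2) := by
        rw [← Real.exp_add]; ring_nf
      have h4 := Real.add_one_le_exp (a / 2)
      have h5 := Real.exp_pos (a / 2)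
      have h6 := mul_le_mul_of_nonneg_left h.integral_exp_le h5.le
      have h7 : (3 : ℝ) / 2 ≤ Real.exp (a / 2) := by push Not at hc; linarith
      have h8 := mul_le_mul_of_nonneg_left h7 h5.le
      simp only [integral_const, probReal_univ, one_smul]
      rw [h3]
      nlinarith

end IsSubGaussian

/-! ### Upper tails for projections of the noise. -/

theorem lintegral_exp_mul_gaussianReal (a : ℝ) :
    ∫⁻ g, ENNReal.ofReal (Real.exp (a * g)) ∂(gaussianReal 0 1) =
      ENNReal.ofReal (Real.exp (a ^ 2 / 2)) := by
  rw [← ofReal_integral_eq_lintegral_ofReal (integrable_exp_mul_gaussianReal a)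
    (Filter.Eventually.of_forall fun _ => (Real.exp_pos _).le)]
  have h := congrFun (mgf_fun_id_gaussianReal (μ := 0) (v := 1)) a
  simp only [mgf, zero_mul, zero_add, NNReal.coe_one, one_mul] at h
  rw [h]

/-- The exact value is `√2`; the cruder bound `e` makes each dimension cost one unit in the
exponent. -/
theorem lintegral_exp_sq_gaussianReal_le :
    ∫⁻ g, ENNReal.ofReal (Real.exp (g ^ 2 / 4)) ∂(gaussianReal 0 1) ≤
      ENNReal.ofReal (Real.exp 1) := by
  have hpi := Real.pi_pos
  have e : ∀ x : ℝ, gaussianPDFReal 0 1 x * Real.exp (x ^ 2 / 4) =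
      (√(2 * Real.pi))⁻¹ * Real.exp (-(1 / 4) * x ^ 2) := fun x => by
    simp only [gaussianPDFReal, NNReal.coe_one, mul_one, sub_zero]
    rw [mul_assoc, ← Real.exp_add]
    ring_nf
  have hi : Integrable (fun x : ℝ => (√(2 * Real.pi))⁻¹ * Real.exp (-(1 / 4) * x ^ 2)) :=
    (integrable_exp_neg_mul_sq (by norm_num)).const_mul _
  rw [gaussianReal_of_var_ne_zero _ one_ne_zero,
    lintegral_withDensity_eq_lintegral_mul _ (measurable_gaussianPDF _ _) (by fun_prop)]
  simp only [Pi.mul_apply, gaussianPDF, ← ENNReal.ofReal_mul (gaussianPDFReal_nonneg _ _ _), e]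
  rw [← ofReal_integral_eq_lintegral_ofReal hi
    (Filter.Eventually.of_forall fun _ => by positivity)]
  apply ENNReal.ofReal_le_ofReal
  rw [integral_const_mul, integral_gaussian, ← Real.sqrt_inv, ← Real.sqrt_mul (by positivity),
    Real.sqrt_le_left (by positivity)]
  have h1 := Real.add_one_le_exp (1 : ℝ)
  have h2 : (2 * Real.pi)⁻¹ * (Real.pi / (1 / 4)) = 2 := by field_simp; norm_num
  rw [h2]
  nlinarith

/-- A family of real random variables as a random vector of the Euclidean space. -/
def euclideanVec {ι Ω : Type*} (ε : ι → Ω → ℝ) (ω : Ω) : EuclideanSpace ℝ ι :=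
  WithLp.toLp 2 fun i => ε i ω

theorem inner_euclideanVec {ι Ω : Type*} [Fintype ι] {ε : ι → Ω → ℝ} (u : EuclideanSpace ℝ ι)
    (ω : Ω) : inner ℝ u (euclideanVec ε ω) = ∑ i, u i * ε i ω := by
  simp [euclideanVec, PiLp.inner_apply, mul_comm]

theorem measurable_euclideanVec {ι Ω : Type*} [MeasurableSpace Ω] {ε : ι → Ω → ℝ}
    (hε : ∀ i, Measurable (ε i)) : Measurable (euclideanVec ε) :=
  (WithLp.measurable_toLp 2 _).comp (measurable_pi_lambda _ hε)

theorem norm_sq_starProjection_eq_sum {κ E : Type*} [Fintype κ] [NormedAddCommGroup E]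
    [InnerProductSpace ℝ E] {V : Submodule ℝ E} [V.HasOrthogonalProjection]
    (b : OrthonormalBasis κ ℝ V) (x : E) :
    ‖V.starProjection x‖ ^ 2 = ∑ k, inner ℝ (b k : E) x ^ 2 := by
  rw [Submodule.starProjection_apply, Submodule.norm_coe, ← b.sum_sq_norm_inner_right]
  simp only [Submodule.inner_orthogonalProjectionOnto_eq_of_mem_left, Real.norm_eq_abs, sq_abs]

section Noise

variable {ι Ω : Type*} [Fintype ι] [MeasurableSpace Ω] {μ : Measure Ω} {ε : ι → Ω → ℝ} {σ : ℝ}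

variable [IsProbabilityMeasure μ]

theorem lintegral_exp_inner_le (hind : iIndepFun ε μ) (hsub : ∀ i, IsSubGaussian (ε i) σ μ)
    (hσ : 0 < σ) (u : EuclideanSpace ℝ ι) :
    ∫⁻ ω, ENNReal.ofReal (Real.exp (inner ℝ u (euclideanVec ε ω))) ∂μ ≤
      ENNReal.ofReal (Real.exp (σ ^ 2 * ‖u‖ ^ 2)) := by
  have hm := fun i => (hsub i).measurable
  have hind' : iIndepFun (fun i ω => ENNReal.ofReal (Real.exp (u i * ε i ω))) μ :=
    hind.comp (fun i x => ENNReal.ofReal (Real.exp (u i * x))) fun i => by fun_prop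
  have h := lintegral_prod_eq_prod_lintegral_of_indepFun Finset.univ _ hind'
    fun i => by have := hm i; fun_prop
  simp only [inner_euclideanVec, Real.exp_sum]
  simp only [ENNReal.ofReal_prod_of_nonneg fun _ _ => (Real.exp_pos _).le]
  rw [h, EuclideanSpace.real_norm_sq_eq, Finset.mul_sum, Real.exp_sum,
    ENNReal.ofReal_prod_of_nonneg fun _ _ => (Real.exp_pos _).le]
  refine Finset.prod_le_prod' fun i _ => ?_
  have hi := (hsub i).integrable_exp_mul_and_le hσ (u i)
  rw [← ofReal_integral_eq_lintegral_ofReal hi.1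
    (Filter.Eventually.of_forall fun _ => (Real.exp_pos _).le)]
  exact ENNReal.ofReal_le_ofReal hi.2

/-- The coordinates `⟨b k, ε⟩` need not be independent, so each square is linearized by an auxiliary
standard Gaussian `g`: `exp (x²/(8σ²)) = E exp (g x/(2σ))`. The linear term `u` lets the induction
close: for fixed `g`, the removed direction joins `u`, and orthogonality adds just `g²/4` to the
exponent. -/
theorem lintegral_exp_sum_sq_inner_le (hind : iIndepFun ε μ)
    (hsub : ∀ i, IsSubGaussian (ε i) σ μ) (hσ : 0 < σ) {κ : Type*}
    {b : κ → EuclideanSpace ℝ ι} (hb : Orthonormal ℝ b) (s : Finset κ)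
    (u : EuclideanSpace ℝ ι) (hu : ∀ k ∈ s, inner ℝ u (b k) = 0) :
    ∫⁻ ω, ENNReal.ofReal (Real.exp (∑ k ∈ s, inner ℝ (b k) (euclideanVec ε ω) ^ 2 / (8 * σ ^ 2) +
      inner ℝ u (euclideanVec ε ω))) ∂μ ≤
      ENNReal.ofReal (Real.exp (s.card + σ ^ 2 * ‖u‖ ^ 2)) := by
  classical
  have hm := measurable_euclideanVec fun i => (hsub i).measurable
  induction s using Finset.induction_on generalizing u with
  | empty => simpa using lintegral_exp_inner_le hind hsub hσ u
  | insert m s hms ih =>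
    have hperp : ∀ g : ℝ, ∀ k ∈ s, inner ℝ (u + (g / (2 * σ)) • b m) (b k) = 0 := fun g k hk => by
      have : m ≠ k := fun h => hms (h ▸ hk)
      rw [inner_add_left, real_inner_smul_left, hu k (Finset.mem_insert_of_mem hk), hb.2 this]
      simp
    have hnorm : ∀ g : ℝ, σ ^ 2 * ‖u + (g / (2 * σ)) • b m‖ ^ 2 =
        σ ^ 2 * ‖u‖ ^ 2 + g ^ 2 / 4 := fun g => by
      rw [norm_add_sq_real, real_inner_smul_right, hu m (Finset.mem_insert_self _ _), norm_smul,
        hb.1 m, Real.norm_eq_abs, mul_one, sq_abs]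
      field_simp
      ring
    have hdec : ∀ ω, ENNReal.ofReal (Real.exp (∑ k ∈ insert m s,
        inner ℝ (b k) (euclideanVec ε ω) ^ 2 / (8 * σ ^ 2) + inner ℝ u (euclideanVec ε ω))) =
        ∫⁻ g, ENNReal.ofReal (Real.exp (∑ k ∈ s,
          inner ℝ (b k) (euclideanVec ε ω) ^ 2 / (8 * σ ^ 2) +
          inner ℝ (u + (g / (2 * σ)) • b m) (euclideanVec ε ω))) ∂(gaussianReal 0 1) := by
      intro ω
      set x := euclideanVec ε ω
      set S := ∑ k ∈ s, inner ℝ (b k) x ^ 2 / (8 * σ ^ 2)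
      have e1 : ∀ g : ℝ, ENNReal.ofReal (Real.exp (S + inner ℝ (u + (g / (2 * σ)) • b m) x)) =
          ENNReal.ofReal (Real.exp (S + inner ℝ u x)) *
            ENNReal.ofReal (Real.exp (inner ℝ (b m) x / (2 * σ) * g)) := fun g => by
        rw [← ENNReal.ofReal_mul (Real.exp_pos _).le, ← Real.exp_add, inner_add_left,
          real_inner_smul_left]
        congr 2
        ring
      simp only [e1]
      rw [lintegral_const_mul _ (by fun_prop), lintegral_exp_mul_gaussianReal,
        ← ENNReal.ofReal_mul (Real.exp_pos _).le, ← Real.exp_add, Finset.sum_insert hms]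
      congr 2
      field_simp
      ring
    calc _ = ∫⁻ ω, ∫⁻ g, ENNReal.ofReal (Real.exp (∑ k ∈ s,
          inner ℝ (b k) (euclideanVec ε ω) ^ 2 / (8 * σ ^ 2) +
          inner ℝ (u + (g / (2 * σ)) • b m) (euclideanVec ε ω))) ∂(gaussianReal 0 1) ∂μ :=
        lintegral_congr hdec
      _ = ∫⁻ g, ∫⁻ ω, ENNReal.ofReal (Real.exp (∑ k ∈ s,
          inner ℝ (b k) (euclideanVec ε ω) ^ 2 / (8 * σ ^ 2) +
          inner ℝ (u + (g / (2 * σ)) • b m) (euclideanVec ε ω))) ∂μ ∂(gaussianReal 0 1) := by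
        refine lintegral_lintegral_swap (Measurable.aemeasurable ?_)
        simp only [Function.uncurry_def]
        have : Measurable fun p : Ω × ℝ => euclideanVec ε p.1 := hm.comp measurable_fst
        fun_prop
      _ ≤ ∫⁻ g, ENNReal.ofReal (Real.exp (s.card + σ ^ 2 * ‖u‖ ^ 2)) *
          ENNReal.ofReal (Real.exp (g ^ 2 / 4)) ∂(gaussianReal 0 1) := by
        refine lintegral_mono fun g => (ih _ (hperp g)).trans_eq ?_
        rw [hnorm, ← ENNReal.ofReal_mul (Real.exp_pos _).le, ← Real.exp_add, add_assoc]
      _ ≤ ENNReal.ofReal (Real.exp (s.card + σ ^ 2 * ‖u‖ ^ 2)) * ENNReal.ofReal (Real.exp 1) := by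
        rw [lintegral_const_mul _ (by fun_prop)]
        gcongr
        exact lintegral_exp_sq_gaussianReal_le
      _ = _ := by
        rw [← ENNReal.ofReal_mul (Real.exp_pos _).le, ← Real.exp_add,
          Finset.card_insert_of_notMem hms]
        push_cast
        ring_nf

/-- An upper tail bound for the length of the projection of sub-Gaussian noise on a subspace. -/
theorem measureReal_norm_sq_starProjection_gt_le (hind : iIndepFun ε μ)
    (hsub : ∀ i, IsSubGaussian (ε i) σ μ) (hσ : 0 < σ)
    (V : Submodule ℝ (EuclideanSpace ℝ ι)) {d t : ℝ} (hd : Module.finrank ℝ V ≤ d) :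
    μ.real {ω | 8 * σ ^ 2 * (d + t) < ‖V.starProjection (euclideanVec ε ω)‖ ^ 2} ≤
      Real.exp (-t) := by
  have hm := measurable_euclideanVec fun i => (hsub i).measurable
  let b := stdOrthonormalBasis ℝ V
  have hb : Orthonormal ℝ fun k => (b k : EuclideanSpace ℝ ι) :=
    b.orthonormal.comp_linearIsometry V.subtypeₗᵢ
  have h1 := lintegral_exp_sum_sq_inner_le hind hsub hσ hb Finset.univ 0 (by simp)
  have h2 : ∀ ω, ENNReal.ofReal (Real.exp (∑ k, inner ℝ (b k : EuclideanSpace ℝ ι)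
      (euclideanVec ε ω) ^ 2 / (8 * σ ^ 2) + inner ℝ 0 (euclideanVec ε ω))) =
      ENNReal.ofReal (Real.exp (‖V.starProjection (euclideanVec ε ω)‖ ^ 2 / (8 * σ ^ 2))) :=
    fun ω => by rw [norm_sq_starProjection_eq_sum b, inner_zero_left, add_zero, Finset.sum_div]
  simp only [h2, norm_zero] at h1
  have h3 : ∫⁻ ω, ENNReal.ofReal (Real.exp
      (‖V.starProjection (euclideanVec ε ω)‖ ^ 2 / (8 * σ ^ 2))) ∂μ ≤
      ENNReal.ofReal (Real.exp d) := by
    refine h1.trans (ENNReal.ofReal_le_ofReal (Real.exp_le_exp.2 ?_))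
    simpa using hd
  have h4 := mul_meas_ge_le_lintegral (μ := μ) (f := fun ω => ENNReal.ofReal (Real.exp
      (‖V.starProjection (euclideanVec ε ω)‖ ^ 2 / (8 * σ ^ 2)))) (by fun_prop)
      (ENNReal.ofReal (Real.exp (d + t)))
  have h5 : {ω | 8 * σ ^ 2 * (d + t) < ‖V.starProjection (euclideanVec ε ω)‖ ^ 2} ⊆
      {ω | ENNReal.ofReal (Real.exp (d + t)) ≤ ENNReal.ofReal (Real.exp
      (‖V.starProjection (euclideanVec ε ω)‖ ^ 2 / (8 * σ ^ 2)))} := fun ω hω => by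
    refine ENNReal.ofReal_le_ofReal (Real.exp_le_exp.2 ?_)
    rw [le_div_iff₀ (by positivity), mul_comm]
    exact (show _ < _ from hω).le
  have h6 : ENNReal.ofReal (Real.exp (d + t)) *
      μ {ω | 8 * σ ^ 2 * (d + t) < ‖V.starProjection (euclideanVec ε ω)‖ ^ 2} ≤
      ENNReal.ofReal (Real.exp d) := (mul_le_mul_right (measure_mono h5) _).trans (h4.trans h3)
  have h7 := ENNReal.toReal_mono (by simp) h6
  rw [ENNReal.toReal_mul, ENNReal.toReal_ofReal (Real.exp_pos _).le,
    ENNReal.toReal_ofReal (Real.exp_pos _).le] at h7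
  rw [Real.exp_neg, ← one_div, le_div_iff₀ (Real.exp_pos _)]
  rw [Real.exp_add, mul_assoc] at h7
  have h8 := (mul_le_iff_le_one_right (Real.exp_pos d)).1 h7
  rw [mul_comm]
  exact h8

end Noise

/-! ### Second moment of a quadratic form and lower tails. -/

theorem sum_sum_eq_sum_diag_add_sum_lt {ι : Type*} [Fintype ι] [LinearOrder ι]
    (g : ι → ι → ℝ) :
    ∑ i, ∑ j, g i j = ∑ i, g i i +
      ∑ q ∈ (Finset.univ : Finset (ι × ι)).filter (fun q => q.1 < q.2),
        (g q.1 q.2 + g q.2 q.1) := by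
  have h : ∀ i j, g i j = (if i = j then g i j else 0) + ((if i < j then g i j else 0) +
      if j < i then g i j else 0) := fun i j => by
    rcases lt_trichotomy i j with h | h | h
    · simp [h, h.ne, h.not_gt]
    · simp [h]
    · simp [h, h.ne', h.not_gt]
  have h2 : ∑ i, ∑ j, (if j < i then g i j else 0) = ∑ i, ∑ j, if i < j then g j i else 0 :=
    Finset.sum_comm
  have h3 : ∀ i j, (if i < j then g i j + g j i else 0) =
      (if i < j then g i j else 0) + if i < j then g j i else 0 := fun i j => by
    split_ifs <;> simp
  rw [Finset.sum_filter, Fintype.sum_prod_type,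
    Fintype.sum_congr _ _ fun i => Fintype.sum_congr _ _ fun j => h i j]
  simp only [h3, Finset.sum_add_distrib, h2, Finset.sum_ite_eq, Finset.mem_univ, if_true]

theorem integral_sq_sum_le_of_pairwise {Ω κ : Type*} [MeasurableSpace Ω] {μ : Measure Ω}
    (s : Finset κ) (a : κ → ℝ) {f : κ → Ω → ℝ} {B : ℝ} (hf : ∀ k ∈ s, MemLp (f k) 2 μ)
    (horth : ∀ k ∈ s, ∀ l ∈ s, k ≠ l → ∫ ω, f k ω * f l ω ∂μ = 0)
    (hB : ∀ k ∈ s, ∫ ω, f k ω ^ 2 ∂μ ≤ B) :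
    ∫ ω, (∑ k ∈ s, a k * f k ω) ^ 2 ∂μ ≤ B * ∑ k ∈ s, a k ^ 2 := by
  have hi : ∀ k ∈ s, ∀ l ∈ s, Integrable (fun ω => a k * a l * (f k ω * f l ω)) μ :=
    fun k hk l hl => ((hf k hk).integrable_mul (hf l hl)).const_mul _
  have e : ∀ ω, (∑ k ∈ s, a k * f k ω) ^ 2 =
      ∑ k ∈ s, ∑ l ∈ s, a k * a l * (f k ω * f l ω) := fun ω => by
    rw [sq, Finset.sum_mul_sum]
    exact Finset.sum_congr rfl fun k _ => Finset.sum_congr rfl fun l _ => by ring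
  simp only [e]
  rw [integral_finsetSum _ fun k hk => integrable_finsetSum _ fun l hl => hi k hk l hl,
    Finset.mul_sum]
  refine Finset.sum_le_sum fun k hk => ?_
  rw [integral_finsetSum _ fun l hl => hi k hk l hl, Finset.sum_eq_single_of_mem k hk]
  · rw [integral_const_mul, mul_comm B, ← sq]
    simp only [← sq]
    exact mul_le_mul_of_nonneg_left (hB k hk) (sq_nonneg _)
  · intro l hl hlk
    rw [integral_const_mul, horth k hk l hl hlk.symm, mul_zero]

section QuadraticForm

variable {ι Ω : Type*} [MeasurableSpace Ω] {μ : Measure Ω} {ε : ι → Ω → ℝ} {σ : ℝ}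

theorem integral_mul_eq_zero_of_indep (hind : iIndepFun ε μ) (hm : ∀ i, Measurable (ε i))
    (h0 : ∀ i, ∫ ω, ε i ω ∂μ = 0) {i j k l : ι} (hij : i ≠ j) (hik : i ≠ k) (hil : i ≠ l) :
    ∫ ω, ε i ω * (ε j ω * ε k ω * ε l ω) ∂μ = 0 := by
  classical
  have h := hind.indepFun_finset {i} {j, k, l} (by simp [hij, hik, hil]) hm
  have hφ : Measurable fun x : ({i} : Finset ι) → ℝ => x ⟨i, by simp⟩ := measurable_pi_apply _
  have hx : ∀ a, Measurable fun x : ({j, k, l} : Finset ι) → ℝ => x a := measurable_pi_apply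
  have h' := h.comp hφ
    (((hx ⟨j, by simp⟩).mul (hx ⟨k, by simp⟩)).mul (hx ⟨l, by simp⟩))
  have h2 := h'.integral_fun_mul_eq_mul_integral
    (by have := hm i; simp only [Function.comp_def]; fun_prop)
    (by have := hm j; have := hm k; have := hm l; simp only [Function.comp_def, Pi.mul_apply]; fun_prop)
  simp only [Function.comp_def, Pi.mul_apply, h0, zero_mul] at h2
  exact h2

theorem integral_sq_mul_sq_of_indep (hind : iIndepFun ε μ) (hm : ∀ i, Measurable (ε i))
    {i j : ι} (hij : i ≠ j) :
    ∫ ω, ε i ω ^ 2 * ε j ω ^ 2 ∂μ = (∫ ω, ε i ω ^ 2 ∂μ) * ∫ ω, ε j ω ^ 2 ∂μ := by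
  have h' := (hind.indepFun hij).comp (φ := fun x => x ^ 2) (ψ := fun x => x ^ 2)
    (by fun_prop) (by fun_prop)
  exact h'.integral_fun_mul_eq_mul_integral
    (by have := hm i; simp only [Function.comp_def]; fun_prop)
    (by have := hm j; simp only [Function.comp_def]; fun_prop)

theorem integral_mul_mul_eq_zero_of_lt [LinearOrder ι] (hind : iIndepFun ε μ)
    (hm : ∀ i, Measurable (ε i)) (h0 : ∀ i, ∫ ω, ε i ω ∂μ = 0) {q r : ι × ι} (hq : q.1 < q.2)
    (hr : r.1 < r.2) (hqr : q ≠ r) :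
    ∫ ω, ε q.1 ω * ε q.2 ω * (ε r.1 ω * ε r.2 ω) ∂μ = 0 := by
  obtain ⟨i, j⟩ := q
  obtain ⟨k, l⟩ := r
  simp only at hq hr ⊢
  by_cases hik : i = k
  · have hjl : j ≠ l := fun h => hqr (by rw [hik, h])
    rw [← integral_mul_eq_zero_of_indep hind hm h0 hq.ne' (hik ▸ hq.ne' : j ≠ k) hjl]
    congr 1; ext ω; ring
  · by_cases hil : i = l
    · subst hil
      rw [← integral_mul_eq_zero_of_indep hind hm h0 hr.ne (hr.trans hq).ne hr.ne]
      congr 1; ext ω; ring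
    · rw [← integral_mul_eq_zero_of_indep hind hm h0 hq.ne hik hil]
      congr 1; ext ω; ring

theorem memLp_two_mul (hsub : ∀ i, IsSubGaussian (ε i) σ μ) (hσ : 0 < σ) (i j : ι) :
    MemLp (fun ω => ε i ω * ε j ω) 2 μ := by
  have hi := (hsub i).measurable
  have hj := (hsub j).measurable
  refine (memLp_two_iff_integrable_sq (by fun_prop)).2 ?_
  refine (((hsub i).integrable_pow_four hσ).add ((hsub j).integrable_pow_four hσ)).mono'
    (by fun_prop) (Filter.Eventually.of_forall fun ω => ?_)
  rw [Real.norm_of_nonneg (sq_nonneg _)]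
  simp only [Pi.add_apply]
  nlinarith [sq_nonneg (ε i ω ^ 2 - ε j ω ^ 2), sq_nonneg (ε i ω ^ 2), sq_nonneg (ε j ω ^ 2)]

variable [IsProbabilityMeasure μ]

/-- The centered squares are pairwise uncorrelated, and so are the products `ε i * ε j` over
distinct pairs `i < j`. Each part is thus bounded by orthogonality and fourth moments, and `(D + O)²
≤ 2D² + 2O²` combines them. -/
theorem integral_sq_quadraticForm_sub_le [Fintype ι] [LinearOrder ι] (hind : iIndepFun ε μ)
    (hsub : ∀ i, IsSubGaussian (ε i) σ μ) (hσ : 0 < σ) (Q : ι → ι → ℝ)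
    (hQ : ∀ i j, Q i j = Q j i) (v : ι → ℝ) (hv : ∀ i, ∫ ω, ε i ω ^ 2 ∂μ = v i) :
    Integrable (fun ω => (∑ i, ∑ j, Q i j * (ε i ω * ε j ω) - ∑ i, Q i i * v i) ^ 2) μ ∧
      ∫ ω, (∑ i, ∑ j, Q i j * (ε i ω * ε j ω) - ∑ i, Q i i * v i) ^ 2 ∂μ ≤
        8 * σ ^ 4 * ∑ i, ∑ j, Q i j ^ 2 := by
  have hm := fun i => (hsub i).measurable
  have hLd : ∀ i, MemLp (fun ω => ε i ω ^ 2 - v i) 2 μ := fun i => by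
    have := memLp_two_mul hsub hσ i i
    simp only [← sq] at this
    exact this.sub (memLp_const _)
  set D : Ω → ℝ := fun ω => ∑ i, Q i i * (ε i ω ^ 2 - v i) with hD
  set S := (Finset.univ : Finset (ι × ι)).filter (fun q => q.1 < q.2) with hS
  set O : Ω → ℝ := fun ω => ∑ q ∈ S, (2 * Q q.1 q.2) * (ε q.1 ω * ε q.2 ω) with hO
  have hdec : ∀ ω, ∑ i, ∑ j, Q i j * (ε i ω * ε j ω) - ∑ i, Q i i * v i = D ω + O ω :=
    fun ω => by
      rw [sum_sum_eq_sum_diag_add_sum_lt, add_sub_right_comm, ← Finset.sum_sub_distrib]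
      congr 1
      · exact Finset.sum_congr rfl fun i _ => by ring
      · exact Finset.sum_congr rfl fun q _ => by rw [hQ q.2 q.1]; ring
  have hDL : MemLp D 2 μ := memLp_finsetSum _ fun i _ => (hLd i).const_mul _
  have hOL : MemLp O 2 μ := memLp_finsetSum _ fun q _ => (memLp_two_mul hsub hσ _ _).const_mul _
  have hDint : ∫ ω, D ω ^ 2 ∂μ ≤ 4 * σ ^ 4 * ∑ i, Q i i ^ 2 := by
    refine integral_sq_sum_le_of_pairwise _ (fun i => Q i i) (fun i _ => hLd i)
      (fun i _ j _ hij => ?_) fun i _ => ?_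
    · have h' := (hind.indepFun hij).comp (φ := fun x => x ^ 2 - v i) (ψ := fun x => x ^ 2 - v j)
        (by fun_prop) (by fun_prop)
      have h2 := h'.integral_fun_mul_eq_mul_integral
        (by have := hm i; simp only [Function.comp_def]; fun_prop)
        (by have := hm j; simp only [Function.comp_def]; fun_prop)
      simp only [Function.comp_def] at h2
      rw [h2, integral_sub ((hsub i).integrable_sq hσ) (integrable_const _)]
      simp [hv]
    · have e : ∀ ω, (ε i ω ^ 2 - v i) ^ 2 = ε i ω ^ 4 - (2 * v i * ε i ω ^ 2 - v i ^ 2) :=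
        fun ω => by ring
      simp only [e]
      have h1 := ((hsub i).integrable_sq hσ).const_mul (2 * v i)
      rw [integral_sub (g := fun ω => 2 * v i * ε i ω ^ 2 - v i ^ 2)
        ((hsub i).integrable_pow_four hσ) (h1.sub (integrable_const _)),
        integral_sub h1 (integrable_const _), integral_const_mul, hv]
      have h2 := (hsub i).integral_pow_four_le hσ
      simp only [integral_const, probReal_univ, one_smul]
      nlinarith [sq_nonneg (v i)]
  have hOint : ∫ ω, O ω ^ 2 ∂μ ≤ σ ^ 4 * ∑ q ∈ S, (2 * Q q.1 q.2) ^ 2 := by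
    refine integral_sq_sum_le_of_pairwise S (fun q => 2 * Q q.1 q.2)
      (f := fun q ω => ε q.1 ω * ε q.2 ω)
      (fun q _ => memLp_two_mul hsub hσ _ _) (fun q hq r hr hqr => ?_) fun q hq => ?_
    · exact integral_mul_mul_eq_zero_of_lt hind hm (fun i => (hsub i).mean_zero)
        (by simpa [hS] using hq) (by simpa [hS] using hr) hqr
    · have hlt : q.1 < q.2 := by simpa [hS] using hq
      simp only [mul_pow]
      rw [integral_sq_mul_sq_of_indep hind hm hlt.ne, show σ ^ 4 = σ ^ 2 * σ ^ 2 by ring]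
      exact mul_le_mul ((hsub _).integral_sq_le hσ) ((hsub _).integral_sq_le hσ)
        (integral_nonneg fun ω => sq_nonneg _) (sq_nonneg _)
  have hsum : ∑ i, ∑ j, Q i j ^ 2 = ∑ i, Q i i ^ 2 + ∑ q ∈ S, 2 * Q q.1 q.2 ^ 2 := by
    rw [sum_sum_eq_sum_diag_add_sum_lt]
    congr 1
    exact Finset.sum_congr rfl fun q _ => by rw [hQ q.2 q.1]; ring
  have h4 : ∑ q ∈ S, (2 * Q q.1 q.2) ^ 2 = 2 * ∑ q ∈ S, 2 * Q q.1 q.2 ^ 2 := by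
    rw [Finset.mul_sum]
    exact Finset.sum_congr rfl fun q _ => by ring
  simp only [hdec]
  refine ⟨(hDL.add hOL).integrable_sq, ?_⟩
  calc ∫ ω, (D ω + O ω) ^ 2 ∂μ ≤ ∫ ω, (2 * D ω ^ 2 + 2 * O ω ^ 2) ∂μ :=
        integral_mono (hDL.add hOL).integrable_sq
          ((hDL.integrable_sq.const_mul 2).add (hOL.integrable_sq.const_mul 2))
          fun ω => by nlinarith [sq_nonneg (D ω - O ω)]
    _ = 2 * ∫ ω, D ω ^ 2 ∂μ + 2 * ∫ ω, O ω ^ 2 ∂μ := by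
        rw [integral_add (hDL.integrable_sq.const_mul 2) (hOL.integrable_sq.const_mul 2),
          integral_const_mul, integral_const_mul]
    _ ≤ 8 * σ ^ 4 * ∑ i, ∑ j, Q i j ^ 2 := by
        rw [h4] at hOint
        rw [hsum]
        have : 0 ≤ σ ^ 4 * ∑ q ∈ S, 2 * Q q.1 q.2 ^ 2 :=
          mul_nonneg (by positivity) (Finset.sum_nonneg fun q _ => by positivity)
        nlinarith

/-- A lower tail bound for the length of the projection of sub-Gaussian noise on a subspace. -/
theorem measureReal_norm_sq_starProjection_lt_le [Fintype ι] [LinearOrder ι]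
    (hind : iIndepFun ε μ) (hsub : ∀ i, IsSubGaussian (ε i) σ μ) (hσ : 0 < σ) {c₀ : ℝ}
    (hc₀ : 0 < c₀) (hvar : ∀ i, c₀ * σ ^ 2 ≤ ∫ ω, ε i ω ^ 2 ∂μ)
    (W : Submodule ℝ (EuclideanSpace ℝ ι)) (hW : 0 < Module.finrank ℝ W) :
    μ.real {ω | ‖W.starProjection (euclideanVec ε ω)‖ ^ 2 <
      c₀ / 2 * Module.finrank ℝ W * σ ^ 2} ≤ 32 / c₀ ^ 2 / Module.finrank ℝ W := by
  set N := Module.finrank ℝ W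
  let b : OrthonormalBasis (Fin N) ℝ W := stdOrthonormalBasis ℝ W
  have hb : Orthonormal ℝ fun k => (b k : EuclideanSpace ℝ ι) :=
    b.orthonormal.comp_linearIsometry W.subtypeₗᵢ
  have hN : (0 : ℝ) < N := Nat.cast_pos.2 hW
  -- `Q` is the matrix of the projection: its trace and its squared Frobenius norm both equal the
  -- rank `N`, so the mean and the variance are both of order `N`.
  let Q : ι → ι → ℝ := fun i j => ∑ k, (b k : EuclideanSpace ℝ ι) i * (b k : EuclideanSpace ℝ ι) j
  have hQ : ∀ i j, Q i j = Q j i := fun i j => Finset.sum_congr rfl fun k _ => mul_comm _ _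
  have hip : ∀ k l, ∑ i, (b k : EuclideanSpace ℝ ι) i * (b l : EuclideanSpace ℝ ι) i =
      if k = l then 1 else 0 := fun k l => by
    rw [← orthonormal_iff_ite.1 hb k l, PiLp.inner_apply]
    simp [mul_comm]
  have htr : ∑ i, Q i i = N := by
    rw [Finset.sum_comm]
    simp [hip]
  have hfro : ∑ i, ∑ j, Q i j ^ 2 = N := by
    have e : ∀ i j, Q i j ^ 2 = ∑ k, ∑ l, ((b k : EuclideanSpace ℝ ι) i *
        (b l : EuclideanSpace ℝ ι) i) * ((b k : EuclideanSpace ℝ ι) j *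
        (b l : EuclideanSpace ℝ ι) j) := fun i j => by
      rw [sq, Finset.sum_mul_sum]
      exact Finset.sum_congr rfl fun k _ => Finset.sum_congr rfl fun l _ => by ring
    calc ∑ i, ∑ j, Q i j ^ 2 = ∑ k, ∑ l, ∑ i, ∑ j, ((b k : EuclideanSpace ℝ ι) i *
        (b l : EuclideanSpace ℝ ι) i) * ((b k : EuclideanSpace ℝ ι) j *
        (b l : EuclideanSpace ℝ ι) j) := by
          simp only [e]
          rw [Finset.sum_congr rfl fun i _ => Finset.sum_comm, Finset.sum_comm]
          refine Finset.sum_congr rfl fun k _ => ?_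
          rw [Finset.sum_congr rfl fun i _ => Finset.sum_comm, Finset.sum_comm]
      _ = N := by simp [← Finset.mul_sum, hip]
  have hform : ∀ ω, ‖W.starProjection (euclideanVec ε ω)‖ ^ 2 =
      ∑ i, ∑ j, Q i j * (ε i ω * ε j ω) := fun ω => by
    rw [norm_sq_starProjection_eq_sum b]
    have e : ∀ k, inner ℝ (b k : EuclideanSpace ℝ ι) (euclideanVec ε ω) ^ 2 =
        ∑ i, ∑ j, (b k : EuclideanSpace ℝ ι) i * (b k : EuclideanSpace ℝ ι) j *
          (ε i ω * ε j ω) := fun k => by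
      rw [inner_euclideanVec, sq, Finset.sum_mul_sum]
      exact Finset.sum_congr rfl fun i _ => Finset.sum_congr rfl fun j _ => by ring
    simp only [e, Q, Finset.sum_mul]
    rw [Finset.sum_comm]
    exact Finset.sum_congr rfl fun i _ => Finset.sum_comm
  obtain ⟨hint, hle⟩ := integral_sq_quadraticForm_sub_le hind hsub hσ Q hQ _ fun _ => rfl
  simp only [← hform] at hint hle
  rw [hfro] at hle
  set m := ∑ i, Q i i * ∫ ω, ε i ω ^ 2 ∂μ
  have hmean : c₀ * N * σ ^ 2 ≤ m := by
    rw [← htr, mul_right_comm, Finset.mul_sum]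
    refine Finset.sum_le_sum fun i _ => ?_
    rw [mul_comm]
    exact mul_le_mul_of_nonneg_left (hvar i)
      (Finset.sum_nonneg fun k _ => mul_self_nonneg _)
  -- Half the lower bound on the mean: falling below `r` is a deviation of at least `r`, and `8σ⁴N /
  -- r² = 32 / (c₀² N)`.
  set r := c₀ / 2 * N * σ ^ 2 with hr
  have hr0 : 0 < r := by positivity
  have hmk := mul_meas_ge_le_integral_of_nonneg
    (Filter.Eventually.of_forall fun ω => sq_nonneg _) hint (r ^ 2)
  have hsubset : {ω | ‖W.starProjection (euclideanVec ε ω)‖ ^ 2 < r} ⊆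
      {ω | r ^ 2 ≤ (‖W.starProjection (euclideanVec ε ω)‖ ^ 2 - m) ^ 2} := fun ω hω => by
    have h1 : ‖W.starProjection (euclideanVec ε ω)‖ ^ 2 < r := hω
    have h2 : 2 * r ≤ m := by rw [hr]; linarith
    change r ^ 2 ≤ _
    nlinarith
  have h3 := (mul_le_mul_of_nonneg_left (measureReal_mono hsubset) (sq_nonneg r)).trans
    (hmk.trans hle)
  rw [div_div, le_div_iff₀ (by positivity)]
  have h4 : r ^ 2 = c₀ ^ 2 * N * (N * σ ^ 4 / 4) := by rw [hr]; ring
  rw [h4] at h3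
  have h5 : 0 < N * σ ^ 4 / 4 := by positivity
  refine le_of_mul_le_mul_right ?_ h5
  linarith

end QuadraticForm

/-! ### Counting supports by complexity. -/

theorem exp_natCast_mul_log_exp_mul_div {d k : ℕ} (hk : 0 < k) (hkd : k ≤ d) :
    Real.exp (k * Real.log (Real.exp 1 * d / k)) = (d / k : ℝ) ^ k * Real.exp k := by
  have hk' : (0 : ℝ) < k := Nat.cast_pos.2 hk
  have hd' : (0 : ℝ) < d := Nat.cast_pos.2 (hk.trans_le hkd)
  rw [Real.exp_nat_mul, Real.exp_log (by positivity), mul_div_assoc, mul_pow, ← Real.exp_nat_mul,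
    mul_one, mul_comm]

theorem natCast_le_mul_log_exp_mul_div {d k : ℕ} (hkd : k ≤ d) :
    (k : ℝ) ≤ k * Real.log (Real.exp 1 * d / k) := by
  rcases k.eq_zero_or_pos with rfl | hk
  · simp
  have hk' : (0 : ℝ) < k := Nat.cast_pos.2 hk
  have hkd' : (k : ℝ) ≤ d := Nat.cast_le.2 hkd
  have hd' : (0 : ℝ) < d := hk'.trans_le hkd'
  have h : 1 ≤ Real.log (Real.exp 1 * d / k) := by
    rw [Real.le_log_iff_exp_le (by positivity), le_div_iff₀ hk']
    gcongr
  nlinarith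

/-- The difference is `(k - 1)(log d - log k) + (k - log k)`. This turns `exp (-P)` into an inverse
power of the dimension. -/
theorem log_le_mul_log_exp_mul_div {d k : ℕ} (hk : 0 < k) (hkd : k ≤ d) :
    Real.log d ≤ k * Real.log (Real.exp 1 * d / k) := by
  have hk' : (1 : ℝ) ≤ k := Nat.one_le_cast.2 hk
  have hkd' : (k : ℝ) ≤ d := Nat.cast_le.2 hkd
  have hd' : (0 : ℝ) < d := by linarith
  rw [Real.log_div (by positivity) (by positivity), Real.log_mul (by positivity) (by positivity),
    Real.log_exp]
  have h1 := Real.log_le_sub_one_of_pos (show (0 : ℝ) < k by linarith)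
  have h2 : Real.log k ≤ Real.log d := Real.log_le_log (by linarith) hkd'
  nlinarith [mul_nonneg (sub_nonneg.2 hk') (sub_nonneg.2 h2)]

theorem choose_le_exp_mul_log {d k : ℕ} (hkd : k ≤ d) :
    (d.choose k : ℝ) ≤ Real.exp (k * Real.log (Real.exp 1 * d / k)) := by
  rcases k.eq_zero_or_pos with rfl | hk
  · simp
  have hk' : (0 : ℝ) < k := Nat.cast_pos.2 hk
  rw [exp_natCast_mul_log_exp_mul_div hk hkd]
  calc (d.choose k : ℝ) ≤ (d : ℝ) ^ k / k.factorial := Nat.choose_le_pow_div k d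
    _ = (d / k : ℝ) ^ k * ((k : ℝ) ^ k / k.factorial) := by
        rw [div_pow]; field_simp
    _ ≤ (d / k : ℝ) ^ k * Real.exp k := by
        gcongr
        exact Real.pow_div_factorial_le_exp _ hk'.le k

/-- One of the three copies pays for the number of supports of a given size; the other two give
`d⁻²` for each of the `d` nonzero sizes. The empty support contributes `1`. -/
theorem sum_exp_neg_three_mul_log_le (d : ℕ) :
    ∑ J : Finset (Fin d), Real.exp (-(3 * (J.card * Real.log (Real.exp 1 * d / J.card)))) ≤
      1 + 1 / d := by
  have h := Finset.sum_powerset_apply_card (x := (Finset.univ : Finset (Fin d))) fun k : ℕ =>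
    Real.exp (-(3 * (k * Real.log (Real.exp 1 * d / k))))
  rw [Finset.powerset_univ] at h
  rw [h, Finset.card_univ, Fintype.card_fin, Finset.sum_range_succ', add_comm]
  refine add_le_add (by simp) ?_
  rcases d.eq_zero_or_pos with rfl | hd
  · simp
  have hd' : (0 : ℝ) < d := Nat.cast_pos.2 hd
  calc _ ≤ ∑ k ∈ Finset.range d, (1 / (d : ℝ)) ^ 2 := by
        refine Finset.sum_le_sum fun k hk => ?_
        have hkd : k + 1 ≤ d := Finset.mem_range.1 hk
        set T := ((k + 1 : ℕ) : ℝ) * Real.log (Real.exp 1 * d / (k + 1 : ℕ))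
        have h1 : (d.choose (k + 1) : ℝ) ≤ Real.exp T := choose_le_exp_mul_log hkd
        have h2 : Real.log d ≤ T := log_le_mul_log_exp_mul_div k.succ_pos hkd
        rw [nsmul_eq_mul]
        calc (d.choose (k + 1) : ℝ) * Real.exp (-(3 * T)) ≤ Real.exp T * Real.exp (-(3 * T)) := by
              gcongr
          _ = Real.exp (-T) ^ 2 := by rw [← Real.exp_add, ← Real.exp_nat_mul]; push_cast; ring_nf
          _ ≤ (1 / (d : ℝ)) ^ 2 := by
              gcongr
              rw [one_div, ← Real.exp_log hd', ← Real.exp_neg]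
              exact Real.exp_le_exp.2 (by linarith)
    _ = 1 / (d : ℝ) := by
        rw [Finset.sum_const, Finset.card_range, nsmul_eq_mul]
        field_simp

/-- The set of nonzero coordinates of a vector. -/
noncomputable def coordSupport {d : ℕ} (v : Fin d → ℝ) : Finset (Fin d) := {i | v i ≠ 0}

theorem hammingNorm_le {d : ℕ} (v : Fin d → ℝ) : hammingNorm v ≤ d := by
  simpa using hammingNorm_le_card_fintype (x := v)

theorem hammingNorm_le_complexity {d : ℕ} (v : Fin d → ℝ) :
    (hammingNorm v : ℝ) ≤ complexity v :=
  natCast_le_mul_log_exp_mul_div (hammingNorm_le v)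

theorem complexity_nonneg {d : ℕ} (v : Fin d → ℝ) : 0 ≤ complexity v :=
  (Nat.cast_nonneg _).trans (hammingNorm_le_complexity v)

theorem exp_neg_complexity_le {d : ℕ} (v : Fin d → ℝ) :
    Real.exp (-complexity v) ≤ (d : ℝ) ^ (-(1 * (min 1 (hammingNorm v) : ℕ) : ℝ)) := by
  rcases (hammingNorm v).eq_zero_or_pos with h | h
  · simp [h, complexity]
  · have hd : (0 : ℝ) < d := Nat.cast_pos.2 (h.trans_le (hammingNorm_le v))
    have hlog : Real.log d ≤ complexity v := log_le_mul_log_exp_mul_div h (hammingNorm_le v)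
    rw [min_eq_left h, Nat.cast_one, mul_one, Real.rpow_neg_one]
    conv_rhs => rw [← Real.exp_log hd]
    rw [← Real.exp_neg]
    exact Real.exp_le_exp.2 (by linarith)

/-! ### Deterministic inequalities for the logarithmic criterion. -/

/-- The product form survives a perfect fit: `log 0 = -∞` on the right forces a zero residual on the
left. -/
theorem mul_exp_le_of_extLog_add_le {a b x y : ℝ} (ha : 0 ≤ a) (hb : 0 ≤ b)
    (h : extLog a + (x : EReal) ≤ extLog b + (y : EReal)) :
    a * Real.exp x ≤ b * Real.exp y := by
  have hlog : ∀ {t : ℝ}, 0 < t → extLog t = (Real.log t : EReal) := fun {t} ht => by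
    rw [extLog, ENNReal.log_ofReal_of_pos ht]
  rcases ha.eq_or_lt with rfl | ha
  · rw [zero_mul]; positivity
  · rcases hb.eq_or_lt with rfl | hb
    · rw [hlog ha] at h
      simp only [extLog, ENNReal.ofReal_zero, ENNReal.log_zero, EReal.bot_add, le_bot_iff,
        ← EReal.coe_add] at h
      exact absurd h (EReal.coe_ne_bot _)
    · rw [hlog ha, hlog hb, ← EReal.coe_add, ← EReal.coe_add, EReal.coe_le_coe_iff] at h
      have := Real.exp_le_exp.2 h
      rwa [Real.exp_add, Real.exp_add, Real.exp_log ha, Real.exp_log hb] at this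

/-- The constraint `δ < 1` serves to make this linearization available; the slope `1/2` in `t` is
what later pays for the complexity of the estimate. -/
theorem exp_sub_le_of_mem_Icc {s t : ℝ} (hs : 0 ≤ s) (hs1 : s ≤ 1) (ht : 0 ≤ t) (ht1 : t ≤ 1) :
    Real.exp (s - t) ≤ 1 + 2 * s - t / 2 := by
  have h1 : Real.exp s ≤ 1 + 2 * s := by
    have := (abs_le.1 (Real.abs_exp_sub_one_sub_id_le (x := s) (by rwa [abs_of_nonneg hs]))).2
    nlinarith
  have h2 : Real.exp (-t) ≤ 1 - t / 2 := by
    have h3 := Real.add_one_le_exp t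
    have h4 : Real.exp (-t) * Real.exp t = 1 := by rw [← Real.exp_add]; simp
    have h5 : 1 ≤ (1 - t / 2) * Real.exp t := by nlinarith
    exact le_of_mul_le_mul_right (h4.trans_le h5) (Real.exp_pos t)
  calc Real.exp (s - t) = Real.exp s * Real.exp (-t) := by rw [← Real.exp_add]; ring_nf
    _ ≤ (1 + 2 * s) * (1 - t / 2) := mul_le_mul h1 h2 (Real.exp_pos _).le (by linarith)
    _ ≤ 1 + 2 * s - t / 2 := by nlinarith

/-- The basic inequality for a minimizer of the logarithm of the residual sum of squares plus a
penalty `A P / N`: here `D` is the estimation error, `e` the noise and `w` the part of the noise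
to which `D` is exposed. -/
theorem norm_sq_le_of_log_criterion {E : Type*} [NormedAddCommGroup E] [InnerProductSpace ℝ E]
    {D e w : E} {A N P Ps L a b σ : ℝ} (hA : 0 < A) (hN : 0 < N) (hP : 0 ≤ P) (hPs : 0 ≤ Ps)
    (hδ : A * P / N ≤ 1) (hδs : A * Ps / N ≤ 1)
    (hcrit : ‖D - e‖ ^ 2 * Real.exp (A * P / N) ≤ ‖e‖ ^ 2 * Real.exp (A * Ps / N))
    (hinner : inner ℝ D e = inner ℝ D w) (hw : ‖w‖ ^ 2 ≤ L * σ ^ 2 * (P + Ps))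
    (hlo : a * N * σ ^ 2 ≤ ‖e‖ ^ 2) (hup : ‖e‖ ^ 2 ≤ b * N * σ ^ 2) (haA : 4 * L ≤ a * A) :
    ‖D‖ ^ 2 ≤ 4 * (L + b * A) * σ ^ 2 * Ps := by
  set δ := A * P / N with hδdef
  set δs := A * Ps / N with hδsdef
  have hδ0 : 0 ≤ δ := by positivity
  have hδs0 : 0 ≤ δs := by positivity
  have h1 : ‖D - e‖ ^ 2 ≤ ‖e‖ ^ 2 * (1 + 2 * δs - δ / 2) := by
    refine le_trans ?_ (mul_le_mul_of_nonneg_left (exp_sub_le_of_mem_Icc hδs0 hδs hδ0 hδ)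
      (sq_nonneg _))
    rw [Real.exp_sub, ← mul_div_assoc, le_div_iff₀ (Real.exp_pos _)]
    exact hcrit
  -- The term `‖D‖² / 2` is absorbed on the left; of `2‖w‖²`, the share `2Lσ²P` is covered by the
  -- gain `aAσ²P/2` of `h4`, since `4L ≤ aA`.
  have h2 : 2 * inner ℝ D e ≤ ‖D‖ ^ 2 / 2 + 2 * ‖w‖ ^ 2 := by
    have := real_inner_le_norm D w
    rw [hinner]
    nlinarith [sq_nonneg (‖D‖ / 2 - ‖w‖)]
  rw [norm_sub_sq_real] at h1
  have h3 : ‖e‖ ^ 2 * (2 * δs) ≤ 2 * b * A * σ ^ 2 * Ps := by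
    calc ‖e‖ ^ 2 * (2 * δs) ≤ b * N * σ ^ 2 * (2 * δs) := by gcongr
      _ = 2 * b * A * σ ^ 2 * Ps := by rw [hδsdef]; field_simp
  have h4 : a * A * σ ^ 2 * P / 2 ≤ ‖e‖ ^ 2 * (δ / 2) := by
    calc a * A * σ ^ 2 * P / 2 = a * N * σ ^ 2 * (δ / 2) := by rw [hδdef]; field_simp
      _ ≤ _ := by gcongr
  have h5 : 4 * L * (σ ^ 2 * P) ≤ a * A * (σ ^ 2 * P) :=
    mul_le_mul_of_nonneg_right haA (by positivity)
  nlinarith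

/-- The criterion after profiling out a linear component `u` ranging over the subspace `U`. -/
theorem profile_criterion {E : Type*} [NormedAddCommGroup E] [InnerProductSpace ℝ E]
    (U : Submodule ℝ E) [U.HasOrthogonalProjection] {u g x : E} (hu : u ∈ U) {δ δs : ℝ}
    (h1 : ∀ u' ∈ U, ‖u + g - x‖ ^ 2 ≤ ‖u' + g - x‖ ^ 2)
    (h2 : ∀ u' ∈ U, ‖u + g - x‖ ^ 2 * Real.exp δ ≤ ‖u' - x‖ ^ 2 * Real.exp δs) :
    ‖Uᗮ.starProjection g - Uᗮ.starProjection x‖ ^ 2 * Real.exp δ ≤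
        ‖Uᗮ.starProjection x‖ ^ 2 * Real.exp δs ∧
      ‖u + g‖ ^ 2 = ‖U.starProjection x‖ ^ 2 + ‖Uᗮ.starProjection g‖ ^ 2 := by
  have hsplit : ∀ v, ‖v‖ ^ 2 = ‖U.starProjection v‖ ^ 2 + ‖Uᗮ.starProjection v‖ ^ 2 :=
    fun v => Submodule.norm_sq_eq_add_norm_sq_starProjection v U
  have hU : ∀ v ∈ U, U.starProjection v = v := fun v hv => Submodule.starProjection_eq_self_iff.2 hv
  have hUp : ∀ v ∈ U, Uᗮ.starProjection v = 0 := fun v hv => by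
    rw [Submodule.starProjection_orthogonal_val, hU v hv, sub_self]
  have hres : ∀ v, U.starProjection v - v = -Uᗮ.starProjection v := fun v => by
    rw [Submodule.starProjection_orthogonal_val]; abel
  constructor
  · have h := h2 _ (U.starProjection_apply_mem x)
    rw [hres, norm_neg] at h
    refine le_trans (mul_le_mul_of_nonneg_right ?_ (Real.exp_pos _).le) h
    rw [hsplit (u + g - x), map_sub Uᗮ.starProjection, map_add Uᗮ.starProjection, hUp u hu,
      zero_add]
    linarith [sq_nonneg ‖U.starProjection (u + g - x)‖]
  -- Optimality against the least-squares choice of `u'` forces the fit and the noise to have the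
  -- same projection on `U`.
  · have h := h1 _ (U.starProjection_apply_mem (x - g))
    rw [show U.starProjection (x - g) + g - x = U.starProjection (x - g) - (x - g) by abel, hres,
      norm_neg, hsplit (u + g - x), map_sub Uᗮ.starProjection, map_add Uᗮ.starProjection,
      hUp u hu, zero_add, map_sub Uᗮ.starProjection, norm_sub_rev (Uᗮ.starProjection x)] at h
    have h0 : U.starProjection (u + g) - U.starProjection x = 0 := by
      rw [← map_sub, ← norm_eq_zero, ← sq_eq_zero_iff]
      exact le_antisymm (by linarith) (sq_nonneg _)
    rw [hsplit (u + g), sub_eq_zero.1 h0, map_add, hUp u hu, zero_add]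

/-! ### Subspaces attached to supports, and the good event. -/

/-- The span of the images under `T` of the coordinate vectors with index in `J`. -/
noncomputable def coordSpan {d : ℕ} {E : Type*} [AddCommGroup E] [Module ℝ E]
    (T : EuclideanSpace ℝ (Fin d) →ₗ[ℝ] E) (J : Finset (Fin d)) : Submodule ℝ E :=
  Submodule.span ℝ ((fun j => T (EuclideanSpace.single j 1)) '' J)

section CoordSpan

variable {d : ℕ} {E : Type*} [AddCommGroup E] [Module ℝ E]
  (T : EuclideanSpace ℝ (Fin d) →ₗ[ℝ] E)

theorem finrank_coordSpan_le (J : Finset (Fin d)) : Module.finrank ℝ (coordSpan T J) ≤ J.card := by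
  classical
  rw [coordSpan, ← Finset.coe_image]
  exact (finrank_span_finset_le_card _).trans Finset.card_image_le

theorem map_mem_coordSpan {J : Finset (Fin d)} (v : EuclideanSpace ℝ (Fin d))
    (hv : ∀ j, v j ≠ 0 → j ∈ J) : T v ∈ coordSpan T J := by
  have h : v = ∑ j, v j • EuclideanSpace.single j (1 : ℝ) := by
    simpa using ((EuclideanSpace.basisFun (Fin d) ℝ).sum_repr v).symm
  rw [h, map_sum]
  refine Submodule.sum_mem _ fun j _ => ?_
  by_cases hj : v j = 0
  · simp [hj]
  · rw [map_smul]
    exact Submodule.smul_mem _ _ (Submodule.subset_span ⟨j, hv j hj, rfl⟩)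

theorem map_toLp_sub_mem_coordSpan (v w : Fin d → ℝ) :
    T (WithLp.toLp 2 (v - w)) ∈ coordSpan T (coordSupport v ∪ coordSupport w) := by
  refine map_mem_coordSpan T _ fun j hj => ?_
  by_contra h
  simp only [coordSupport, Finset.mem_union, Finset.mem_filter, Finset.mem_univ, true_and,
    not_or, not_not] at h
  simp [h.1, h.2] at hj

theorem finrank_coordSpan_union_le (J : Finset (Fin d)) (v : Fin d → ℝ) :
    (Module.finrank ℝ (coordSpan T (J ∪ coordSupport v)) : ℝ) ≤
      J.card * Real.log (Real.exp 1 * d / J.card) + complexity v := by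
  have h : Module.finrank ℝ (coordSpan T (J ∪ coordSupport v)) ≤ J.card + hammingNorm v :=
    (finrank_coordSpan_le T _).trans (Finset.card_union_le _ _)
  have h1 : (J.card : ℝ) ≤ J.card * Real.log (Real.exp 1 * d / J.card) :=
    natCast_le_mul_log_exp_mul_div (by simpa using J.card_le_univ)
  have h2 := hammingNorm_le_complexity v
  have h3 : (Module.finrank ℝ (coordSpan T (J ∪ coordSupport v)) : ℝ) ≤
      J.card + hammingNorm v := by exact_mod_cast h
  linarith

end CoordSpan

/-- The event on which the noise behaves well on a finite family of subspaces `V k` and on a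
subspace `W` of large dimension. -/
theorem exists_event_norm_sq_starProjection {ι Ω κ : Type*} [Fintype ι] [LinearOrder ι]
    [MeasurableSpace Ω] {μ : Measure Ω} [IsProbabilityMeasure μ] {ε : ι → Ω → ℝ} {σ : ℝ}
    (hind : iIndepFun ε μ) (hsub : ∀ i, IsSubGaussian (ε i) σ μ) (hσ : 0 < σ) {c₀ : ℝ}
    (hc₀ : 0 < c₀) (hvar : ∀ i, c₀ * σ ^ 2 ≤ ∫ ω, ε i ω ^ 2 ∂μ)
    (W : Submodule ℝ (EuclideanSpace ℝ ι)) {N : ℝ} (hN : Module.finrank ℝ W = N) (hN0 : 0 < N)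
    (F : Finset κ) (V : κ → Submodule ℝ (EuclideanSpace ℝ ι)) (d t : κ → ℝ)
    (hd : ∀ k ∈ F, Module.finrank ℝ (V k) ≤ d k) :
    ∃ E : Set Ω, MeasurableSet E ∧
      1 - (32 / c₀ ^ 2 + 1) * N⁻¹ - ∑ k ∈ F, Real.exp (-t k) ≤ μ.real E ∧
      ∀ ω ∈ E, (∀ k ∈ F, ‖(V k).starProjection (euclideanVec ε ω)‖ ^ 2 ≤
          8 * σ ^ 2 * (d k + t k)) ∧
        c₀ / 2 * N * σ ^ 2 ≤ ‖W.starProjection (euclideanVec ε ω)‖ ^ 2 ∧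
        ‖W.starProjection (euclideanVec ε ω)‖ ^ 2 ≤ 16 * N * σ ^ 2 := by
  have hm := measurable_euclideanVec fun i => (hsub i).measurable
  have hmV : ∀ V : Submodule ℝ (EuclideanSpace ℝ ι),
      Measurable fun ω => ‖V.starProjection (euclideanVec ε ω)‖ ^ 2 := fun V => by fun_prop
  set B : κ → Set Ω := fun k =>
    {ω | 8 * σ ^ 2 * (d k + t k) < ‖(V k).starProjection (euclideanVec ε ω)‖ ^ 2} with hB
  set B₁ : Set Ω := {ω | ‖W.starProjection (euclideanVec ε ω)‖ ^ 2 < c₀ / 2 * N * σ ^ 2} with hB₁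
  -- Dimension and deviation are both `N`, hence the constant 16 and the failure probability `exp
  -- (-N) ≤ N⁻¹`.
  set B₂ : Set Ω :=
    {ω | 8 * σ ^ 2 * (N + N) < ‖W.starProjection (euclideanVec ε ω)‖ ^ 2} with hB₂
  have hBm : MeasurableSet ((⋃ k ∈ F, B k) ∪ (B₁ ∪ B₂)) :=
    (Finset.measurableSet_biUnion _ fun k _ => measurableSet_lt measurable_const (hmV _)).union
      ((measurableSet_lt (hmV _) measurable_const).union
        (measurableSet_lt measurable_const (hmV _)))
  refine ⟨((⋃ k ∈ F, B k) ∪ (B₁ ∪ B₂))ᶜ, hBm.compl, ?_, fun ω hω => ?_⟩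
  · rw [probReal_compl_eq_one_sub hBm]
    have h1 : μ.real (⋃ k ∈ F, B k) ≤ ∑ k ∈ F, Real.exp (-t k) :=
      (measureReal_biUnion_finset_le _ _).trans (Finset.sum_le_sum fun k hk =>
        measureReal_norm_sq_starProjection_gt_le hind hsub hσ (V k) (hd k hk))
    have h2 : μ.real B₁ ≤ 32 / c₀ ^ 2 / N := by
      have := measureReal_norm_sq_starProjection_lt_le hind hsub hσ hc₀ hvar W
        (by rw [← Nat.cast_pos (α := ℝ), hN]; exact hN0)
      rwa [hN] at this
    have h3 : μ.real B₂ ≤ N⁻¹ := by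
      refine (measureReal_norm_sq_starProjection_gt_le hind hsub hσ W hN.le).trans ?_
      rw [Real.exp_neg]
      have := Real.add_one_le_exp N
      gcongr
      linarith
    have h4 : μ.real ((⋃ k ∈ F, B k) ∪ (B₁ ∪ B₂)) ≤
        μ.real (⋃ k ∈ F, B k) + (μ.real B₁ + μ.real B₂) :=
      (measureReal_union_le _ _).trans (by gcongr; exact measureReal_union_le _ _)
    rw [div_eq_mul_inv _ N] at h2
    linarith
  · simp only [Set.mem_compl_iff, Set.mem_union, Set.mem_iUnion, hB, hB₁, hB₂, Set.mem_ofPred_eq,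
      not_or, not_exists, not_lt] at hω
    exact ⟨fun k hk => hω.1 k hk, hω.2.1, hω.2.2.trans_eq (by ring)⟩

section Model

variable {n p : ℕ} (X : Matrix (Fin n) (Fin p) ℝ) (β βs : Fin p → ℝ) (γ γs : Fin n → ℝ)

theorem sqNorm_sysComp_sub_response {Ω : Type*} (ε : Fin n → Ω → ℝ) (ω : Ω) :
    sqNorm (sysComp X β γ - (sysComp X βs γs + fun i => ε i ω)) =
      ‖Matrix.toEuclideanLin X (WithLp.toLp 2 (β - βs)) + WithLp.toLp 2 (γ - γs) -
        euclideanVec ε ω‖ ^ 2 := by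
  rw [sqNorm]
  congr 2
  ext i
  simp [sysComp, euclideanVec]
  ring

theorem breg2_sysComp :
    breg2 (sysComp X β γ) (sysComp X βs γs) =
      ‖Matrix.toEuclideanLin X (WithLp.toLp 2 (β - βs)) + WithLp.toLp 2 (γ - γs)‖ ^ 2 / 2 := by
  rw [breg2, sqNorm]
  congr 3
  ext i
  simp [sysComp]
  ring

theorem finrank_range_toEuclideanLin :
    Module.finrank ℝ (LinearMap.range (Matrix.toEuclideanLin X)) = X.rank := by
  rw [Matrix.rank_eq_finrank_range_toLin X (PiLp.basisFun 2 ℝ (Fin n))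
    (PiLp.basisFun 2 ℝ (Fin p)), Matrix.toEuclideanLin, Matrix.toLpLin_eq_toLin]

end Model

theorem inner_starProjection_right_of_mem {E : Type*} [NormedAddCommGroup E]
    [InnerProductSpace ℝ E] {V : Submodule ℝ E} [V.HasOrthogonalProjection] {D : E} (hD : D ∈ V)
    (x : E) : inner ℝ D (V.starProjection x) = inner ℝ D x := by
  rw [← Submodule.inner_starProjection_left_eq_right, Submodule.starProjection_eq_self_iff.2 hD]

/-- When `γ = 0`, the empty support would contribute `1` and make the probability bound useless. It
can be dropped, because its subspace is trivial. -/
theorem sum_filter_exp_neg_le {n : ℕ} (γ : Fin n → ℝ) :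
    ∑ K : Finset (Fin n) with K.Nonempty ∨ hammingNorm γ ≠ 0,
      Real.exp (-(3 * (K.card * Real.log (Real.exp 1 * n / K.card)) + complexity γ)) ≤
        2 * (n : ℝ)⁻¹ := by
  have h := sum_exp_neg_three_mul_log_le n
  rw [one_div] at h
  have hn : (n : ℝ)⁻¹ ≤ 1 := Nat.cast_inv_le_one n
  have hn0 : 0 ≤ (n : ℝ)⁻¹ := by positivity
  simp only [neg_add, Real.exp_add, ← Finset.sum_mul]
  by_cases hγ : hammingNorm γ = 0
  · have e : complexity γ = 0 := by simp [complexity, hγ]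
    have hF : (Finset.univ.filter fun K : Finset (Fin n) => K.Nonempty ∨ hammingNorm γ ≠ 0) =
        Finset.univ.erase ∅ := by
      ext K
      simp [hγ, Finset.nonempty_iff_ne_empty]
    rw [hF, e, neg_zero, Real.exp_zero, mul_one]
    rw [← Finset.add_sum_erase _ _ (Finset.mem_univ ∅)] at h
    simp only [Finset.card_empty, Nat.cast_zero, zero_mul, mul_zero, neg_zero, Real.exp_zero] at h
    linarith
  · have h2 := exp_neg_complexity_le γ
    rw [min_eq_left (Nat.one_le_iff_ne_zero.2 hγ), Nat.cast_one, mul_one, Real.rpow_neg_one] at h2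
    have h3 := Finset.sum_le_sum_of_subset_of_nonneg (Finset.filter_subset
      (fun K : Finset (Fin n) => K.Nonempty ∨ hammingNorm γ ≠ 0) Finset.univ)
      (f := fun K => Real.exp (-(3 * (K.card * Real.log (Real.exp 1 * n / K.card)))))
      fun _ _ _ => (Real.exp_pos _).le
    exact mul_le_mul (h3.trans (h.trans (by linarith))) h2 (Real.exp_pos _).le (by norm_num)

/-! ### The two regimes. -/

section Main

variable {Ω : Type*} [MeasurableSpace Ω] {μ : Measure Ω} [IsProbabilityMeasure μ]
  {n p : ℕ} {σ c₀ A A₀ : ℝ} {ε : Fin n → Ω → ℝ}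

theorem coordSpan_empty {d : ℕ} {E : Type*} [AddCommGroup E] [Module ℝ E]
    (T : EuclideanSpace ℝ (Fin d) →ₗ[ℝ] E) : coordSpan T ∅ = ⊥ := by
  simp [coordSpan]

theorem exists_event_low (hc₀ : 0 < c₀) (hA : 256 / c₀ ≤ A) (hA₀ : A < A₀) (hpn : p < n)
    (X : Matrix (Fin n) (Fin p) ℝ) (hX : X.rank = p) (βs : Fin p → ℝ) (γs : Fin n → ℝ)
    (hγs : complexity γs ≤ ((n : ℝ) - p) / A₀) (hσ : 0 < σ) (hind : iIndepFun ε μ)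
    (hsub : ∀ i, IsSubGaussian (ε i) σ μ) (hvar : ∀ i, c₀ * σ ^ 2 ≤ ∫ ω, ε i ω ^ 2 ∂μ) :
    ∃ E : Set Ω, MeasurableSet E ∧
      1 - (32 / c₀ ^ 2 + 4) * ((n : ℝ) - p) ^ (-1 : ℝ)
        - (if hammingNorm γs = 0 then (32 / c₀ ^ 2 + 4) * Real.exp (-1 * p) else 0) ≤ μ.real E ∧
      ∀ ω ∈ E, ∀ (βh : Fin p → ℝ) (γh : Fin n → ℝ),
        IsLowMinimizer A X (sysComp X βs γs + fun i => ε i ω) βh γh →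
        breg2 (sysComp X βh γh) (sysComp X βs γs) ≤
          (68 + 32 * A) * (σ ^ 2 * complexity γs + p * σ ^ 2) := by
  have hA0 : 0 < A := lt_of_lt_of_le (by positivity) hA
  have hNpos : 0 < (n : ℝ) - p := sub_pos.2 (Nat.cast_lt.2 hpn)
  set N : ℝ := (n : ℝ) - p with hNdef
  have hPs := complexity_nonneg γs
  have hδs : lowPenalty p A γs < 1 := by
    rw [lowPenalty, div_lt_one hNpos]
    have h1 := mul_le_mul_of_nonneg_left hγs hA0.le
    have h2 : A * (N / A₀) < N := by
      rw [← mul_div_assoc, div_lt_iff₀ (hA0.trans hA₀), mul_comm]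
      exact mul_lt_mul_of_pos_left hA₀ hNpos
    linarith
  set L := Matrix.toEuclideanLin X with hL
  set U := LinearMap.range L with hU
  have hUp : Module.finrank ℝ U = p := (finrank_range_toEuclideanLin X).trans hX
  have hWN : (Module.finrank ℝ Uᗮ : ℝ) = N := by
    have h := U.finrank_add_finrank_orthogonal
    rw [hUp, finrank_euclideanSpace_fin] at h
    have h' : (p : ℝ) + Module.finrank ℝ Uᗮ = n := by exact_mod_cast h
    rw [hNdef, ← h']
    ring
  -- After profiling, the coordinate vectors matter only through their components orthogonal to the
  -- column space.
  let T : EuclideanSpace ℝ (Fin n) →ₗ[ℝ] EuclideanSpace ℝ (Fin n) := Uᗮ.starProjection.toLinearMap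
  let F₀ : Finset (Finset (Fin n)) :=
    Finset.univ.filter fun K => K.Nonempty ∨ hammingNorm γs ≠ 0
  let P : Finset (Fin n) → ℝ := fun K => K.card * Real.log (Real.exp 1 * n / K.card)
  obtain ⟨E, hE, hprob, hgood⟩ := exists_event_norm_sq_starProjection hind hsub hσ hc₀ hvar Uᗮ
    hWN hNpos (Finset.insertNone F₀)
    (fun k => k.elim U fun K => coordSpan T (K ∪ coordSupport γs))
    (fun k => k.elim p fun K => P K + complexity γs)
    -- The index `none` is the column space. For a support `K`, `3 * P K` pays for the union bound
    -- and `complexity γs` yields the extra factor `1/n` when `γs ≠ 0`.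
    (fun k => k.elim (p + complexity γs) fun K => 3 * P K + complexity γs)
    (by
      rintro (_ | K) -
      · exact (Nat.cast_inj.2 hUp).le
      · exact finrank_coordSpan_union_le T K γs)
  refine ⟨E, hE, ?_, fun ω hω βh γh hmin => ?_⟩
  · refine le_trans ?_ hprob
    rw [Finset.sum_insertNone, Real.rpow_neg_one]
    have h1 : ∑ K ∈ F₀, Real.exp (-(3 * P K + complexity γs)) ≤ 2 * (n : ℝ)⁻¹ :=
      sum_filter_exp_neg_le γs
    have h2 : (n : ℝ)⁻¹ ≤ N⁻¹ := by
      gcongr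
      rw [hNdef]
      linarith [(Nat.cast_nonneg p : (0 : ℝ) ≤ p)]
    have h3 : Real.exp (-(p + complexity γs)) ≤ N⁻¹ +
        if hammingNorm γs = 0 then (32 / c₀ ^ 2 + 4) * Real.exp (-1 * p) else 0 := by
      split_ifs with h0
      · have e : Real.exp (-(p + complexity γs)) ≤ Real.exp (-1 * p) :=
          Real.exp_le_exp.2 (by linarith)
        have h4 : 1 * Real.exp (-1 * p) ≤ (32 / c₀ ^ 2 + 4) * Real.exp (-1 * p) := by
          gcongr
          have : 0 ≤ 32 / c₀ ^ 2 := by positivity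
          linarith
        have h5 : 0 < N⁻¹ := by positivity
        linarith
      · have h4 := exp_neg_complexity_le γs
        rw [min_eq_left (Nat.one_le_iff_ne_zero.2 h0), Nat.cast_one, mul_one,
          Real.rpow_neg_one] at h4
        have e : Real.exp (-(p + complexity γs)) ≤ Real.exp (-complexity γs) :=
          Real.exp_le_exp.2 (by linarith [(Nat.cast_nonneg p : (0 : ℝ) ≤ p)])
        linarith
    change _ ≤ 1 - (32 / c₀ ^ 2 + 1) * N⁻¹ - (Real.exp (-(p + complexity γs)) +
      ∑ K ∈ F₀, Real.exp (-(3 * P K + complexity γs)))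
    linarith
  obtain ⟨hV, hlo, hup⟩ := hgood ω hω
  obtain ⟨hδ, hopt⟩ := hmin
  set x := euclideanVec ε ω
  set g : EuclideanSpace ℝ (Fin n) := WithLp.toLp 2 (γh - γs)
  set u := L (WithLp.toLp 2 (βh - βs))
  have hres : ∀ b γ', sqNorm (sysComp X (WithLp.ofLp b + βs) γ' -
      (sysComp X βs γs + fun i => ε i ω)) = ‖L b + WithLp.toLp 2 (γ' - γs) - x‖ ^ 2 :=
    fun b γ' => by rw [sqNorm_sysComp_sub_response, add_sub_cancel_right]
  have hcmp : ∀ b γ', lowPenalty p A γ' < 1 → ‖u + g - x‖ ^ 2 * Real.exp (lowPenalty p A γh) ≤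
      ‖L b + WithLp.toLp 2 (γ' - γs) - x‖ ^ 2 * Real.exp (lowPenalty p A γ') := fun b γ' h => by
    have := hopt (WithLp.ofLp b + βs) γ' h
    rw [sqNorm_sysComp_sub_response, hres] at this
    exact mul_exp_le_of_extLog_add_le (sq_nonneg _) (sq_nonneg _) this
  obtain ⟨hcrit, hpyth⟩ := profile_criterion U (u := u) (g := g) (x := x) ⟨_, rfl⟩
    (δ := lowPenalty p A γh) (δs := lowPenalty p A γs)
    (by
      rintro _ ⟨b, rfl⟩
      exact le_of_mul_le_mul_right (hcmp b γh hδ) (Real.exp_pos _))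
    (by
      rintro _ ⟨b, rfl⟩
      simpa using hcmp b γs hδs)
  have hw : ‖(coordSpan T (coordSupport γh ∪ coordSupport γs)).starProjection x‖ ^ 2 ≤
      32 * σ ^ 2 * (complexity γh + complexity γs) := by
    have hPh := complexity_nonneg γh
    by_cases hK : coordSupport γh ∈ F₀
    · have h : _ ≤ 8 * σ ^ 2 * (complexity γh + complexity γs +
          (3 * complexity γh + complexity γs)) := hV (some _) (Finset.some_mem_insertNone.2 hK)
      refine h.trans ?_
      nlinarith [mul_nonneg (sq_nonneg σ) hPs]
    · have hK' : coordSupport γh = ∅ ∧ coordSupport γs = ∅ := by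
        simp only [F₀, Finset.mem_filter, Finset.mem_univ, true_and, not_or, not_not,
          Finset.not_nonempty_iff_eq_empty] at hK
        exact ⟨hK.1, Finset.card_eq_zero.1 hK.2⟩
      rw [hK'.1, hK'.2, Finset.empty_union, coordSpan_empty]
      simp only [Submodule.starProjection_bot, zero_apply, norm_zero]
      exact (by norm_num : (0 : ℝ) ^ 2 = 0).trans_le
        (mul_nonneg (by positivity) (add_nonneg hPh hPs))
  have hDmem : Uᗮ.starProjection g ∈ coordSpan T (coordSupport γh ∪ coordSupport γs) :=
    map_toLp_sub_mem_coordSpan T γh γs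
  -- Here `L = 32` is `8` times dimension `P` plus deviation `3P`, and `a = c₀/2`; the condition `4L
  -- ≤ aA` is the origin of `256 / c₀`.
  have haA : 4 * 32 ≤ c₀ / 2 * A := by
    rw [div_le_iff₀ hc₀] at hA
    linarith
  have hD := norm_sq_le_of_log_criterion (D := Uᗮ.starProjection g) (e := Uᗮ.starProjection x)
    hA0 hNpos (complexity_nonneg γh) hPs hδ.le hδs.le hcrit
    (by rw [inner_starProjection_right_of_mem (Uᗮ.starProjection_apply_mem g),
      inner_starProjection_right_of_mem hDmem]) hw hlo hup haA
  have hpU : ‖U.starProjection x‖ ^ 2 ≤ 8 * σ ^ 2 * (p + (p + complexity γs)) :=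
    hV none Finset.none_mem_insertNone
  rw [breg2_sysComp]
  change ‖u + g‖ ^ 2 / 2 ≤ _
  rw [hpyth]
  -- Half of `4(32 + 16A)σ²Ps` plus half of `8σ²(2p + Ps)` gives the constant `68 + 32A`.
  have h1 : 0 ≤ A * (p * σ ^ 2) := by positivity
  have h2 : 0 ≤ p * σ ^ 2 := by positivity
  nlinarith

theorem exists_event_high (hc₀ : 0 < c₀) (hA : 256 / c₀ ≤ A) (hA₀ : A < A₀) (hn : 0 < n)
    (X : Matrix (Fin n) (Fin p) ℝ) (βs : Fin p → ℝ) (γs : Fin n → ℝ)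
    (hs : complexity βs + complexity γs ≤ (n : ℝ) / A₀) (hσ : 0 < σ) (hind : iIndepFun ε μ)
    (hsub : ∀ i, IsSubGaussian (ε i) σ μ) (hvar : ∀ i, c₀ * σ ^ 2 ≤ ∫ ω, ε i ω ^ 2 ∂μ) :
    ∃ E : Set Ω, MeasurableSet E ∧
      1 - (32 / c₀ ^ 2 + 1) * (n : ℝ) ^ (-1 : ℝ)
        - 4 * (n : ℝ) ^ (-(1 * (min 1 (hammingNorm γs) : ℕ)) : ℝ)
          * (p : ℝ) ^ (-(1 * (min 1 (hammingNorm βs) : ℕ)) : ℝ) ≤ μ.real E ∧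
      ∀ ω ∈ E, ∀ (βh : Fin p → ℝ) (γh : Fin n → ℝ),
        IsHighMinimizer A X (sysComp X βs γs + fun i => ε i ω) βh γh →
        breg2 (sysComp X βh γh) (sysComp X βs γs) ≤
          (64 + 32 * A) * (σ ^ 2 * (complexity βs + complexity γs)) := by
  have hA0 : 0 < A := lt_of_lt_of_le (by positivity) hA
  have hNpos : 0 < (n : ℝ) := Nat.cast_pos.2 hn
  have hPβ := complexity_nonneg βs
  have hPγ := complexity_nonneg γs
  have hδs : highPenalty A βs γs < 1 := by
    rw [highPenalty, div_lt_one hNpos]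
    have h1 := mul_le_mul_of_nonneg_left hs hA0.le
    have h2 : A * (n / A₀) < n := by
      rw [← mul_div_assoc, div_lt_iff₀ (hA0.trans hA₀), mul_comm]
      exact mul_lt_mul_of_pos_left hA₀ hNpos
    linarith
  set L := Matrix.toEuclideanLin X with hL
  have hWN : (Module.finrank ℝ (⊤ : Submodule ℝ (EuclideanSpace ℝ (Fin n))) : ℝ) = n := by
    rw [finrank_top, finrank_euclideanSpace_fin]
  let P : ∀ {d : ℕ}, Finset (Fin d) → ℝ := fun {d} K =>
    K.card * Real.log (Real.exp 1 * d / K.card)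
  let V : Finset (Fin p) × Finset (Fin n) → Submodule ℝ (EuclideanSpace ℝ (Fin n)) := fun k =>
    coordSpan L (k.1 ∪ coordSupport βs) ⊔ coordSpan LinearMap.id (k.2 ∪ coordSupport γs)
  -- Nothing is profiled out, so the whole noise vector sets the scale, and the union bound runs
  -- over pairs of supports.
  obtain ⟨E, hE, hprob, hgood⟩ := exists_event_norm_sq_starProjection hind hsub hσ hc₀ hvar ⊤
    hWN hNpos Finset.univ V
    (fun k => (P k.1 + complexity βs) + (P k.2 + complexity γs))
    (fun k => (3 * P k.1 + complexity βs) + (3 * P k.2 + complexity γs))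
    (fun k _ => by
      have h : Module.finrank ℝ (V k) ≤ _ := Submodule.finrank_add_le_finrank_add_finrank _ _
      have h' : (Module.finrank ℝ (V k) : ℝ) ≤
        Module.finrank ℝ (coordSpan L (k.1 ∪ coordSupport βs)) + Module.finrank ℝ
          (coordSpan (LinearMap.id (R := ℝ) (M := EuclideanSpace ℝ (Fin n)))
            (k.2 ∪ coordSupport γs)) := by exact_mod_cast h
      exact h'.trans (add_le_add (finrank_coordSpan_union_le _ _ _)
        (finrank_coordSpan_union_le _ _ _)))
  refine ⟨E, hE, ?_, fun ω hω βh γh hmin => ?_⟩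
  · refine le_trans ?_ hprob
    rw [Real.rpow_neg_one, Fintype.sum_prod_type]
    refine sub_le_sub_left ?_ _
    simp only [neg_add, Real.exp_add, ← Finset.mul_sum, ← Finset.sum_mul]
    have hsum : ∀ d : ℕ, ∑ J : Finset (Fin d), Real.exp (-(3 * P J)) ≤ 2 := fun d => by
      have h := sum_exp_neg_three_mul_log_le d
      have h' := Nat.cast_inv_le_one (α := ℝ) d
      rw [one_div] at h
      exact h.trans (by linarith)
    have h1 := exp_neg_complexity_le βs
    have h2 := exp_neg_complexity_le γs
    -- The sum over pairs factors. Empty supports are kept, so for `βs = 0` and `γs = 0` the bound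
    -- `4` exceeds `1` and the probability claim is void.
    calc _ ≤ (2 * (p : ℝ) ^ (-(1 * (min 1 (hammingNorm βs) : ℕ)) : ℝ)) *
          (2 * (n : ℝ) ^ (-(1 * (min 1 (hammingNorm γs) : ℕ)) : ℝ)) := by
          gcongr
          · exact hsum p
          · exact hsum n
      _ = _ := by ring
  obtain ⟨hV, hlo, hup⟩ := hgood ω hω
  obtain ⟨hδ, hopt⟩ := hmin
  rw [Submodule.starProjection_top, ContinuousLinearMap.id_apply] at hlo hup
  set x := euclideanVec ε ω
  set D := L (WithLp.toLp 2 (βh - βs)) + WithLp.toLp 2 (γh - γs)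
  have hcrit : ‖D - x‖ ^ 2 * Real.exp (highPenalty A βh γh) ≤
      ‖x‖ ^ 2 * Real.exp (highPenalty A βs γs) := by
    have h := hopt βs γs hδs
    rw [sqNorm_sysComp_sub_response, sqNorm_sysComp_sub_response] at h
    replace h := mul_exp_le_of_extLog_add_le (div_nonneg (sq_nonneg _) zero_le_two)
      (div_nonneg (sq_nonneg _) zero_le_two) h
    simp only [sub_self, WithLp.toLp_zero, map_zero, zero_add, zero_sub, norm_neg] at h
    change ‖D - x‖ ^ 2 / 2 * _ ≤ ‖x‖ ^ 2 / 2 * _ at h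
    linarith
  have hw : ‖(V (coordSupport βh, coordSupport γh)).starProjection x‖ ^ 2 ≤
      32 * σ ^ 2 * ((complexity βh + complexity γh) + (complexity βs + complexity γs)) := by
    have h : _ ≤ 8 * σ ^ 2 * (((complexity βh + complexity βs) + (complexity γh + complexity γs)) +
      ((3 * complexity βh + complexity βs) + (3 * complexity γh + complexity γs))) :=
      hV (coordSupport βh, coordSupport γh) (Finset.mem_univ _)
    refine h.trans ?_
    nlinarith [mul_nonneg (sq_nonneg σ) hPβ, mul_nonneg (sq_nonneg σ) hPγ]
  have hDmem : D ∈ V (coordSupport βh, coordSupport γh) :=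
    Submodule.add_mem_sup (map_toLp_sub_mem_coordSpan L βh βs)
      (map_toLp_sub_mem_coordSpan LinearMap.id γh γs)
  have haA : 4 * 32 ≤ c₀ / 2 * A := by
    rw [div_le_iff₀ hc₀] at hA
    linarith
  have hD := norm_sq_le_of_log_criterion (D := D) (e := x) hA0 hNpos
    (add_nonneg (complexity_nonneg βh) (complexity_nonneg γh)) (add_nonneg hPβ hPγ)
    hδ.le hδs.le hcrit (inner_starProjection_right_of_mem hDmem x).symm hw hlo hup haA
  rw [breg2_sysComp]
  change ‖D‖ ^ 2 / 2 ≤ _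
  linarith

end Main

theorem theorem8 (c₀ : ℝ) (hc₀ : 0 < c₀) :
    -- the case of a full-column-rank design, without sparsity in `β`
    (∃ Amin : ℝ, 0 < Amin ∧ ∀ A : ℝ, Amin ≤ A → ∀ A₀ : ℝ, A < A₀ →
      ∃ C c c' : ℝ, 0 < C ∧ 0 < c ∧ 0 < c' ∧
        ∀ (n p : ℕ) (_ : p < n) (X : Matrix (Fin n) (Fin p) ℝ) (_ : X.rank = p)
          (βs : Fin p → ℝ) (γs : Fin n → ℝ)
          (_ : complexity γs ≤ ((n : ℝ) - p) / A₀)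
          (Ω : Type*) (_ : MeasurableSpace Ω) (μ : Measure Ω) (_ : IsProbabilityMeasure μ)
          (σ : ℝ) (_ : 0 < σ) (ε : Fin n → Ω → ℝ)
          (_ : iIndepFun ε μ) (_ : ∀ i, IsSubGaussian (ε i) σ μ)
          (v : Fin n → ℝ) (_ : ∀ i, c₀ ≤ v i)
          (_ : ∀ i, ∫ ω, ε i ω ^ 2 ∂μ = v i * σ ^ 2),
          ∃ E : Set Ω, MeasurableSet E ∧
            1 - c * ((n : ℝ) - p) ^ (-c')
                - (if hammingNorm γs = 0 then c * Real.exp (-c' * p) else 0) ≤ μ.real E ∧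
            ∀ ω ∈ E, ∀ (βh : Fin p → ℝ) (γh : Fin n → ℝ),
              IsLowMinimizer A X (sysComp X βs γs + fun i => ε i ω) βh γh →
              breg2 (sysComp X βh γh) (sysComp X βs γs) ≤
                C * (σ ^ 2 * complexity γs + p * σ ^ 2)) ∧
    -- the high-dimensional case, with a possibly sparse `β` and an arbitrary design
    (∃ Amin : ℝ, 0 < Amin ∧ ∀ A : ℝ, Amin ≤ A → ∀ A₀ : ℝ, A < A₀ →
      ∃ K C C' c c' : ℝ, 0 < K ∧ 0 < C ∧ 0 < C' ∧ 0 < c ∧ 0 < c' ∧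
        ∀ (n p : ℕ) (_ : 0 < n) (X : Matrix (Fin n) (Fin p) ℝ)
          (βs : Fin p → ℝ) (γs : Fin n → ℝ)
          (_ : complexity βs + complexity γs ≤ (n : ℝ) / A₀)
          (Ω : Type*) (_ : MeasurableSpace Ω) (μ : Measure Ω) (_ : IsProbabilityMeasure μ)
          (σ : ℝ) (_ : 0 < σ) (ε : Fin n → Ω → ℝ)
          (_ : iIndepFun ε μ) (_ : ∀ i, IsSubGaussian (ε i) σ μ)
          (v : Fin n → ℝ) (_ : ∀ i, c₀ ≤ v i)
          (_ : ∀ i, ∫ ω, ε i ω ^ 2 ∂μ = v i * σ ^ 2),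
          ∃ E : Set Ω, MeasurableSet E ∧
            1 - C' * (n : ℝ) ^ (-c')
                - C * (n : ℝ) ^ (-(c * (min 1 (hammingNorm γs) : ℕ)))
                    * (p : ℝ) ^ (-(c * (min 1 (hammingNorm βs) : ℕ))) ≤ μ.real E ∧
            ∀ ω ∈ E, ∀ (βh : Fin p → ℝ) (γh : Fin n → ℝ),
              IsHighMinimizer A X (sysComp X βs γs + fun i => ε i ω) βh γh →
              breg2 (sysComp X βh γh) (sysComp X βs γs) ≤
                K * (σ ^ 2 * (complexity βs + complexity γs))) := by
  refine ⟨⟨256 / c₀, by positivity, fun A hA A₀ hA₀ => ?_⟩,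
    ⟨256 / c₀, by positivity, fun A hA A₀ hA₀ => ?_⟩⟩
  · have hA0 : 0 < A := lt_of_lt_of_le (by positivity) hA
    refine ⟨68 + 32 * A, 32 / c₀ ^ 2 + 4, 1, by positivity, by positivity, one_pos, ?_⟩
    intro n p hpn X hX βs γs hγs Ω _ μ _ σ hσ ε hind hsub v hv hvar
    exact exists_event_low hc₀ hA hA₀ hpn X hX βs γs hγs hσ hind hsub fun i =>
      (mul_le_mul_of_nonneg_right (hv i) (sq_nonneg σ)).trans_eq (hvar i).symm
  · have hA0 : 0 < A := lt_of_lt_of_le (by positivity) hA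
    refine ⟨64 + 32 * A, 4, 32 / c₀ ^ 2 + 1, 1, 1, by positivity, by norm_num, by positivity,
      one_pos, one_pos, ?_⟩
    intro n p hn X βs γs hs Ω _ μ _ σ hσ ε hind hsub v hv hvar
    exact exists_event_high hc₀ hA hA₀ hn X βs γs hs hσ hind hsub fun i =>
      (mul_le_mul_of_nonneg_right (hv i) (sq_nonneg σ)).trans_eq (hvar i).symm
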